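/- Let $\Lambda=\begin{pmatrix}0&0&-1&0\\0&0&0&-1\\1&0&0&-2\\0&1&2&0\end{pmatrix}$ and $\widetilde B=\begin{pmatrix}0&2\\-2&0\\1&0\\0&1\end{pmatrix}$ (the Kronecker quiver with principal coefficients). Let $\mathcal T$ be the quantum torus over $\mathbb Z[\mathfrak q^{\pm 1/2}]$ with basis $\{X^{e}: e\in\mathbb Z^4\}$ and product $X^{e}X^{f}=\mathfrak q^{\Lambda(e,f)/2}X^{e+f}$, where $\Lambda(e,f)=e^{T}\Lambda f$, and let $\mathcal F$ be its skew-field of fractions. Consider the quantum seeds obtained from the initial seed $(\Lambda,\widetilde B,\{x_1=X^{e_1},x_2=X^{e_2},y_1=X^{e_3},y_2=X^{e_4}\})$ by finite sequences of (Berenstein–Zelevinsky) quantum seed mutations in the directions $1,2$. The cluster variables are the first two variables $X'_1,X'_2$ of these seeds $(\Lambda',\widetilde B',X')$, and the cluster monomials are the normalized monomials $X'^{(a,b,0,0)}=\mathfrak q^{-\frac12\Lambda'_{12}ab}X_1'^{a}X_2'^{b}$ with $a,b\ge 0$. Let $R=\mathbb Z[\mathfrak q^{\pm1/2}][y_1^{\pm},y_2^{\pm}]\subset\mathcal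 F$ be the subring generated by $\mathfrak q^{\pm1/2},y_1^{\pm1},y_2^{\pm1}$ (here $y_1y_2=\mathfrak q^{-2}y_2y_1$), let $R_{\ge0}=\mathbb Z_{\ge 0}[\mathfrak q^{\pm1/2}][y_1^{\pm},y_2^{\pm}]$ be the subsemiring generated by the same elements, and let $\mathcal A_{\mathfrak q}(Q)\subset\mathcal F$ be the subring generated by $R$ and all cluster variables. The bar-involution on $\mathcal T$ is the $\mathbb Z$-linear map $\mathfrak q^{r/2}X^{e}\mapsto \mathfrak q^{-r/2}X^{e}$. Put $$X_\delta=X^{(1,-1,1,1)}+X^{(-1,-1,1,0)}+X^{(-1,1,0,0)},$$ and let $S_0=1$, $S_1=X_\delta$, $S_{n+1}=S_nX_\delta-X^{(0,0,1,1)}S_{n-1}$ for $n\ge1$ be the modified Chebyshev elements of the second kind. Theorem 4.3. The elements $S_n$, $n\ge1$, are pairwise distinct and none of them is a cluster monomial. The set $$\mathcal S=\{\text{cluster monomials}\}\sqcup\{S_n : n\ge 1\}$$ is a basis of $\mathcal A_{\mathfrak q}(Q)$ over $R$, both as a left $R$-module and as a right $R$-module. Every element of $\mathcal S$ is bar-invariant,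 that is, it lies in $\mathcal T$ and is fixed by the bar-involution. The (left and right) structure constants of $\mathcal S$ lie in $R_{\ge0}$: the product of any two elements of $\mathcal S$ is a finite left (and a finite right) linear combination of elements of $\mathcal S$ with coefficients in $R_{\ge0}$. -/

import Mathlib

open Matrix

/-- The group of monomials `q^(r/2) X^e` (`r : ℤ`, `e : ℤ^N`) of the quantum torus of `Λ`, with
`q^(r/2) X^e * q^(s/2) X^f = q^((r + s + Λ(e, f))/2) X^(e + f)`. -/
@[ext]
structure TorusMonomial {N : ℕ} (Λ : Matrix (Fin N) (Fin N) ℤ) where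
  /-- the exponent of `q^(1/2)` -/
  half : ℤ
  /-- the exponent vector -/
  exp : Fin N → ℤ

namespace TorusMonomial

variable {N : ℕ} {Λ : Matrix (Fin N) (Fin N) ℤ}

instance : Mul (TorusMonomial Λ) :=
  ⟨fun a b => ⟨a.half + b.half + a.exp ⬝ᵥ (Λ *ᵥ b.exp), a.exp + b.exp⟩⟩

instance : One (TorusMonomial Λ) := ⟨⟨0, 0⟩⟩

instance : Inv (TorusMonomial Λ) :=
  ⟨fun a => ⟨-a.half + a.exp ⬝ᵥ (Λ *ᵥ a.exp), -a.exp⟩⟩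

@[simp] theorem mul_half (a b : TorusMonomial Λ) :
    (a * b).half = a.half + b.half + a.exp ⬝ᵥ (Λ *ᵥ b.exp) := rfl
@[simp] theorem mul_exp (a b : TorusMonomial Λ) : (a * b).exp = a.exp + b.exp := rfl
@[simp] theorem one_half : (1 : TorusMonomial Λ).half = 0 := rfl
@[simp] theorem one_exp : (1 : TorusMonomial Λ).exp = 0 := rfl
@[simp] theorem inv_half (a : TorusMonomial Λ) :
    (a⁻¹).half = -a.half + a.exp ⬝ᵥ (Λ *ᵥ a.exp) := rfl
@[simp] theorem inv_exp (a : TorusMonomial Λ) : (a⁻¹).exp = -a.exp := rfl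

instance : Group (TorusMonomial Λ) :=
  Group.ofLeftAxioms
    (fun a b c => by
      ext1
      · simp [add_dotProduct, Matrix.mulVec_add]; ring
      · simp [add_assoc])
    (fun a => by ext1 <;> simp)
    (fun a => by ext1 <;> simp)

/-- Order the monomials lexicographically by exponent vector, then by power of `q`. -/
def toLexPair (a : TorusMonomial Λ) : Lex (Lex (Fin N → ℤ) × ℤ) := toLex (toLex a.exp, a.half)

theorem toLexPair_injective : Function.Injective (toLexPair (Λ := Λ)) := by
  intro a b h
  simp only [toLexPair, EmbeddingLike.apply_eq_iff_eq, Prod.mk.injEq] at h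
  exact TorusMonomial.ext h.2 h.1

theorem toLexPair_mul_lt {a b c : TorusMonomial Λ} (h : toLexPair b < toLexPair c) :
    toLexPair (a * b) < toLexPair (a * c) := by
  simp only [toLexPair, Prod.Lex.toLex_lt_toLex, mul_exp, mul_half, toLex_add] at h ⊢
  rcases h with h | ⟨h1, h2⟩
  · exact Or.inl (by gcongr)
  · have h3 : b.exp = c.exp := by simpa using h1
    exact Or.inr ⟨by rw [h1], by rw [h3]; linarith⟩

instance : UniqueProds (TorusMonomial Λ) := by
  let _ : LinearOrder (TorusMonomial Λ) := LinearOrder.lift' toLexPair toLexPair_injective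
  have : MulLeftStrictMono (TorusMonomial Λ) := ⟨fun a b c h => toLexPair_mul_lt h⟩
  infer_instance

end TorusMonomial

/-- The quantum torus of `Λ`: integer combinations of the monomials `q^(r/2) X^e`, that is, the
`ℤ[q^(±1/2)]`-algebra with basis `X^e` and product `X^e X^f = q^(Λ(e,f)/2) X^(e+f)`. -/
abbrev QuantumTorus {N : ℕ} (Λ : Matrix (Fin N) (Fin N) ℤ) := MonoidAlgebra ℤ (TorusMonomial Λ)

namespace QuantumTorus

variable {N : ℕ} {Λ : Matrix (Fin N) (Fin N) ℤ}

/-- The element `q^(r/2) X^e` of the quantum torus. -/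
noncomputable def mon (r : ℤ) (e : Fin N → ℤ) : QuantumTorus Λ := MonoidAlgebra.single ⟨r, e⟩ 1

/-- The `ℤ`-linear bar-involution `q^(r/2) X^e ↦ q^(-r/2) X^e`. -/
noncomputable def bar : QuantumTorus Λ → QuantumTorus Λ :=
  MonoidAlgebra.mapDomain fun a => ⟨-a.half, a.exp⟩

/-- The monomials with all exponents bounded by `n` and power of `q^(1/2)` bounded by `K n²`. -/
def InBox (K n : ℕ) (a : TorusMonomial Λ) : Prop :=
  (∀ i, |a.exp i| ≤ (n : ℤ)) ∧ |a.half| ≤ (K : ℤ) * n ^ 2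

theorem abs_form_le (e f : Fin N → ℤ) (n c : ℕ) (he : ∀ i, |e i| ≤ (n : ℤ))
    (hf : ∀ i, |f i| ≤ (c : ℤ)) :
    |e ⬝ᵥ (Λ *ᵥ f)| ≤ (∑ i, ∑ j, |Λ i j|) * (n * c) := by
  simp only [dotProduct, Matrix.mulVec, Finset.mul_sum, Finset.sum_mul]
  refine (Finset.abs_sum_le_sum_abs _ _).trans (Finset.sum_le_sum fun i _ => ?_)
  refine (Finset.abs_sum_le_sum_abs _ _).trans (Finset.sum_le_sum fun j _ => ?_)
  rw [abs_mul, abs_mul]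
  calc |e i| * (|Λ i j| * |f j|) = |Λ i j| * (|e i| * |f j|) := by ring
    _ ≤ _ := by gcongr; exacts [he i, hf j]

theorem InBox.mul {K n c : ℕ} (hK : ∑ i, ∑ j, |Λ i j| ≤ (K : ℤ)) {a b : TorusMonomial Λ}
    (ha : InBox K n a) (hb : InBox K c b) : InBox K (n + c) (a * b) := by
  refine ⟨fun i => ?_, ?_⟩
  · have := abs_add_le (a.exp i) (b.exp i)
    have h1 := ha.1 i
    have h2 := hb.1 i
    simp only [TorusMonomial.mul_exp, Pi.add_apply]
    push_cast
    linarith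
  · have h := abs_form_le (Λ := Λ) a.exp b.exp n c ha.1 hb.1
    have h' : (∑ i, ∑ j, |Λ i j|) * ((n : ℤ) * c) ≤ K * (n * c) := by gcongr
    have h1 := ha.2
    have h2 := hb.2
    have h3 := abs_add_three a.half b.half (a.exp ⬝ᵥ (Λ *ᵥ b.exp))
    have h4 : (0 : ℤ) ≤ K * (n * c) := by positivity
    simp only [TorusMonomial.mul_half]
    push_cast
    nlinarith

open Classical in
/-- The box of `InBox` as a finite set. -/
noncomputable def box (Λ : Matrix (Fin N) (Fin N) ℤ) (K n : ℕ) : Finset (TorusMonomial Λ) :=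
  ((Finset.Icc (-((K : ℤ) * n ^ 2)) (K * n ^ 2)) ×ˢ
    Fintype.piFinset (fun _ : Fin N => Finset.Icc (-(n : ℤ)) n)).image fun p => ⟨p.1, p.2⟩

theorem mem_box {K n : ℕ} {a : TorusMonomial Λ} : a ∈ box Λ K n ↔ InBox K n a := by
  simp only [box, Finset.mem_image, Finset.mem_product, Finset.mem_Icc, Fintype.mem_piFinset,
    InBox, abs_le, Prod.exists]
  constructor
  · rintro ⟨r, e, ⟨h1, h2⟩, rfl⟩
    exact ⟨h2, h1⟩
  · rintro ⟨h1, h2⟩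
    exact ⟨a.half, a.exp, ⟨h2, h1⟩, rfl⟩

open Classical in
theorem card_box (K n : ℕ) : (box Λ K n).card = (2 * (K * n ^ 2) + 1) * (2 * n + 1) ^ N := by
  rw [box, Finset.card_image_of_injective]
  · rw [Finset.card_product, Fintype.card_piFinset]
    simp only [Int.card_Icc, Finset.prod_const, Finset.card_univ, Fintype.card_fin]
    congr 1
    · have : (0 : ℤ) ≤ (K : ℤ) * n ^ 2 := by positivity
      zify
      rw [Int.toNat_of_nonneg (by linarith)]
      ring
    · congr 1; omega
  · rintro ⟨a, b⟩ ⟨c, d⟩ h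
    simpa using h

theorem exists_box (x : QuantumTorus Λ) (K : ℕ) (hK : 1 ≤ K) :
    ∃ c, ∀ a ∈ x.coeff.support, ∀ m, c ≤ m → InBox K m a := by
  refine ⟨∑ a ∈ x.coeff.support, (a.half.natAbs + ∑ i, (a.exp i).natAbs), fun a ha m hm => ?_⟩
  have h := Finset.single_le_sum (f := fun a : TorusMonomial Λ =>
    a.half.natAbs + ∑ i, (a.exp i).natAbs) (fun _ _ => Nat.zero_le _) ha
  refine ⟨fun i => ?_, ?_⟩
  · have h2 := Finset.single_le_sum (f := fun i => (a.exp i).natAbs)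
      (fun _ _ => Nat.zero_le _) (Finset.mem_univ i)
    rw [Int.abs_eq_natAbs]
    omega
  · have h3 : |a.half| ≤ (m : ℤ) := by rw [Int.abs_eq_natAbs]; omega
    have h4 : (m : ℤ) ≤ (m : ℤ) ^ 2 := by exact_mod_cast Nat.le_self_pow (by norm_num) m
    have h5 : (1 : ℤ) ≤ K := by exact_mod_cast hK
    nlinarith [sq_nonneg (m : ℤ)]

open Classical in
theorem mul_mem_span {K n c : ℕ} (hK : ∑ i, ∑ j, |Λ i j| ≤ (K : ℤ)) (x : QuantumTorus Λ)
    (hx : ∀ a ∈ x.coeff.support, InBox K c a) (g : TorusMonomial Λ) (hg : g ∈ box Λ K n) :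
    MonoidAlgebra.single g (1 : ℤ) * x ∈ Submodule.span ℤ
      (((box Λ K (n + c)).image fun h => MonoidAlgebra.single h (1 : ℤ) :
        Finset (QuantumTorus Λ)) : Set (QuantumTorus Λ)) := by
  have hx' : x = ∑ a ∈ x.coeff.support, MonoidAlgebra.single a (x.coeff a) := by
    conv_lhs => rw [← MonoidAlgebra.sum_coeff_single x]
    rfl
  rw [hx', Finset.mul_sum]
  refine Submodule.sum_mem _ fun a ha => ?_
  rw [MonoidAlgebra.single_mul_single, one_mul,
    show MonoidAlgebra.single (g * a) (x.coeff a) =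
      x.coeff a • MonoidAlgebra.single (g * a) (1 : ℤ) by simp]
  refine Submodule.smul_mem _ _ (Submodule.subset_span ?_)
  rw [Finset.mem_coe, Finset.mem_image]
  exact ⟨g * a, mem_box.2 ((mem_box.1 hg).mul hK (hx a ha)), rfl⟩

theorem linearIndependent_single :
    LinearIndependent ℤ fun g : TorusMonomial Λ => (MonoidAlgebra.single g 1 : QuantumTorus Λ) :=
  (Finsupp.linearIndependent_single_one ℤ (TorusMonomial Λ)).map'
    (MonoidAlgebra.coeffLinearEquiv ℤ).symm.toLinearMap (LinearEquiv.ker _)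

theorem exists_small_growth (N K c : ℕ) (hc : 1 ≤ c) : ∃ n : ℕ,
    (2 * (K * (n + c) ^ 2) + 1) * (2 * (n + c) + 1) ^ N <
      2 * ((2 * (K * n ^ 2) + 1) * (2 * n + 1) ^ N) := by
  by_contra! H
  set P : ℕ → ℕ := fun n => (2 * (K * n ^ 2) + 1) * (2 * n + 1) ^ N with hP
  have h1 : ∀ k, 2 ^ k ≤ P (k * c) := by
    intro k
    induction k with
    | zero => simp [hP]
    | succ k ih =>
      have := H (k * c)
      have e : (k + 1) * c = k * c + c := by ring
      rw [e, pow_succ]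
      simp only [hP] at ih ⊢
      omega
  have h2 : ∀ k, 1 ≤ k → P (k * c) ≤ ((2 * K + 1) * (3 * c) ^ (N + 2)) * k ^ (N + 2) := by
    intro k hk
    have hkc : 1 ≤ k * c := Nat.mul_pos hk hc
    have a1 : 2 * (K * (k * c) ^ 2) + 1 ≤ (2 * K + 1) * (3 * c * k) ^ 2 := by
      have : 1 ≤ (k * c) ^ 2 := Nat.one_le_pow _ _ hkc
      nlinarith
    have a2 : 2 * (k * c) + 1 ≤ 3 * c * k := by nlinarith
    calc P (k * c) ≤ ((2 * K + 1) * (3 * c * k) ^ 2) * (3 * c * k) ^ N :=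
          Nat.mul_le_mul a1 (Nat.pow_le_pow_left a2 N)
      _ = _ := by ring
  have h3 := (tendsto_pow_const_div_const_pow_of_one_lt (N + 2) (one_lt_two (α := ℝ))).const_mul
    (((2 * K + 1) * (3 * c) ^ (N + 2) : ℕ) : ℝ)
  rw [mul_zero] at h3
  obtain ⟨k, hk1, hk2⟩ := ((h3.eventually_lt_const zero_lt_one).and
    (Filter.eventually_ge_atTop 1)).exists
  rw [← mul_div_assoc, div_lt_one (by positivity)] at hk1
  have h4 := (h1 k).trans (h2 k hk2)
  have h5 : (2 : ℝ) ^ k ≤ (((2 * K + 1) * (3 * c) ^ (N + 2) : ℕ) : ℝ) * (k : ℝ) ^ (N + 2) := by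
    exact_mod_cast h4
  linarith

/-- The quantum torus satisfies the Ore condition. -/
theorem exists_common_multiple (x y : QuantumTorus Λ) (hy : y ≠ 0) :
    ∃ u v : QuantumTorus Λ, u ≠ 0 ∧ u * x = v * y := by
  classical
  by_contra! H
  obtain ⟨K, hK1, hK⟩ : ∃ K : ℕ, 1 ≤ K ∧ ∑ i, ∑ j, |Λ i j| ≤ (K : ℤ) :=
    ⟨(∑ i, ∑ j, |Λ i j|).toNat + 1, by omega, by
      push_cast
      have := Int.self_le_toNat (∑ i, ∑ j, |Λ i j|)
      omega⟩
  obtain ⟨c1, h1⟩ := exists_box x K hK1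
  obtain ⟨c2, h2⟩ := exists_box y K hK1
  set c := c1 + c2 + 1
  obtain ⟨n, hn⟩ := exists_small_growth N K c (by omega)
  let v : (box Λ K n) ⊕ (box Λ K n) → QuantumTorus Λ :=
    Sum.elim (fun g => MonoidAlgebra.single g.1 1 * x) (fun g => -(MonoidAlgebra.single g.1 1 * y))
  have hli : LinearIndependent ℤ v := by
    rw [Fintype.linearIndependent_iff]
    intro w hw
    have hs : ∀ w' : box Λ K n → ℤ,
        ∑ g, w' g • (MonoidAlgebra.single g.1 1 : QuantumTorus Λ) = 0 → ∀ g, w' g = 0 :=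
      Fintype.linearIndependent_iff.1
        (linearIndependent_single.comp (fun g : box Λ K n => g.1) Subtype.val_injective)
    have hw' : (∑ g, w (Sum.inl g) • (MonoidAlgebra.single g.1 1 : QuantumTorus Λ)) * x =
        (∑ g, w (Sum.inr g) • (MonoidAlgebra.single g.1 1 : QuantumTorus Λ)) * y := by
      rw [Fintype.sum_sum_type] at hw
      simp only [v, Sum.elim_inl, Sum.elim_inr, smul_neg, Finset.sum_neg_distrib] at hw
      rw [Finset.sum_mul, Finset.sum_mul]
      simp only [smul_mul_assoc]
      exact eq_of_sub_eq_zero (by rw [sub_eq_add_neg]; exact hw)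
    have hl : (∑ g, w (Sum.inl g) • (MonoidAlgebra.single g.1 1 : QuantumTorus Λ)) = 0 := by
      by_contra h0
      exact H _ _ h0 hw'
    rw [hl, zero_mul] at hw'
    have hr := (mul_eq_zero.1 hw'.symm).resolve_right hy
    rintro (g | g)
    · exact hs _ hl g
    · exact hs _ hr g
  have hcard := linearIndependent_le_span' v hli
    (((box Λ K (n + c)).image fun h => (MonoidAlgebra.single h 1 : QuantumTorus Λ) :
      Finset (QuantumTorus Λ)) : Set (QuantumTorus Λ)) (by
      rintro _ ⟨g | g, rfl⟩
      · exact mul_mem_span hK x (fun a ha => h1 a ha c (by omega)) g.1 g.2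
      · exact Submodule.neg_mem _ (mul_mem_span hK y (fun a ha => h2 a ha c (by omega)) g.1 g.2))
  rw [Cardinal.mk_fintype, Nat.cast_le] at hcard
  have h6 := hcard.trans ((Fintype.card_coe _).le.trans Finset.card_image_le)
  rw [ Fintype.card_sum, Fintype.card_coe, card_box,
    card_box] at h6
  omega

open scoped nonZeroDivisors in
noncomputable instance oreSet : OreLocalization.OreSet (QuantumTorus Λ)⁰ :=
  Classical.choice <| OreLocalization.nonempty_oreSet_iff_of_noZeroDivisors.2 fun x y => by
    obtain ⟨u, v, hu, h⟩ := exists_common_multiple x y.1 (nonZeroDivisors.ne_zero y.2)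
    exact ⟨v, ⟨u, mem_nonZeroDivisors_of_ne_zero hu⟩, h⟩

end QuantumTorus

open scoped nonZeroDivisors in
/-- The skew-field of fractions of the quantum torus. -/
abbrev QuantumTorus.Frac {N : ℕ} (Λ : Matrix (Fin N) (Fin N) ℤ) :=
  OreLocalization (QuantumTorus Λ)⁰ (QuantumTorus Λ)


open scoped nonZeroDivisors in
/-- The (injective) inclusion of the quantum torus into its skew-field of fractions. -/
noncomputable def QuantumTorus.toFrac {N : ℕ} (Λ : Matrix (Fin N) (Fin N) ℤ) :
    QuantumTorus Λ →+* QuantumTorus.Frac Λ :=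
  OreLocalization.numeratorRingHom (S := (QuantumTorus Λ)⁰)

/-- The data `(Λ, B̃, X)` of a quantum seed in a division ring `F`, with `n` mutable directions
(the indices `Fin.castAdd f k`) and `f` frozen ones (the indices `Fin.natAdd n j`). -/
@[ext]
structure QuantumSeed (F : Type*) (n f : ℕ) where
  /-- the quasi-commutation matrix `Λ` -/
  Lam : Matrix (Fin (n + f)) (Fin (n + f)) ℤ
  /-- the exchange matrix `B̃` -/
  B : Matrix (Fin (n + f)) (Fin n) ℤ
  /-- the variables `X_1, ..., X_(n+f)` -/
  X : Fin (n + f) → F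

namespace QuantumSeed

variable {F : Type*} [DivisionRing F] {n f : ℕ}

/-- The normalized monomial `X^e = v^(-∑_{i<j} Λ_ij e_i e_j) X_1^(e_1) ⋯ X_m^(e_m)` of a seed, where
`v` stands for `q^(1/2)`. With this normalization `X^a X^b = v^(Λ(a,b)) X^(a+b)`. -/
def monomial (v : F) (S : QuantumSeed F n f) (e : Fin (n + f) → ℤ) : F :=
  v ^ (-∑ i, ∑ j ∈ Finset.Ioi i, S.Lam i j * e i * e j) *
    (List.ofFn fun i => S.X i ^ e i).prod

/-- The matrix `E` which governs the mutation of `Λ` in direction `k`. -/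
def mutationMatrix (B : Matrix (Fin (n + f)) (Fin n) ℤ) (k : Fin n) :
    Matrix (Fin (n + f)) (Fin (n + f)) ℤ :=
  Matrix.of fun i j =>
    if j = Fin.castAdd f k then (if i = Fin.castAdd f k then -1 else max 0 (-B i k))
    else if i = j then 1 else 0

/-- The mutation of a quantum seed in direction `k`, with `v` in the role of `q^(1/2)`. -/
def mutate (v : F) (S : QuantumSeed F n f) (k : Fin n) : QuantumSeed F n f where
  Lam := (mutationMatrix S.B k)ᵀ * S.Lam * mutationMatrix S.B k
  B := Matrix.of fun i j =>
    if i = Fin.castAdd f k ∨ j = k then -S.B i j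
    else S.B i j + max 0 (S.B i k) * S.B (Fin.castAdd f k) j +
      S.B i k * max 0 (-S.B (Fin.castAdd f k) j)
  X := Function.update S.X (Fin.castAdd f k)
    (S.monomial v (fun j => max 0 (S.B j k) - if j = Fin.castAdd f k then 1 else 0) +
      S.monomial v (fun j => max 0 (-S.B j k) - if j = Fin.castAdd f k then 1 else 0))

/-- `S'` is obtained from `S` by a finite sequence of mutations. -/
def MutationEquivalent (v : F) : QuantumSeed F n f → QuantumSeed F n f → Prop :=
  Relation.ReflTransGen fun S S' => ∃ k, S' = S.mutate v k

/-- The cluster variables of all seeds reachable from `S`. -/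
def clusterVariables (v : F) (S : QuantumSeed F n f) : Set F :=
  {x | ∃ S', MutationEquivalent v S S' ∧ ∃ k, x = S'.X (Fin.castAdd f k)}

/-- The cluster monomials: the normalized monomials `X'^e` in all seeds reachable from `S`, where
`e` has non-negative entries and vanishes at the frozen indices. -/
def clusterMonomials (v : F) (S : QuantumSeed F n f) : Set F :=
  {x | ∃ S', MutationEquivalent v S S' ∧ ∃ e : Fin (n + f) → ℤ,
    (∀ i, 0 ≤ e i) ∧ (∀ j, e (Fin.natAdd n j) = 0) ∧ x = S'.monomial v e}

/-- The elements `q^(±1/2)` and `y^(±1)` for the frozen variables `y`. -/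
def coeffGenerators (v : F) (S : QuantumSeed F n f) : Set F :=
  {v, v⁻¹} ∪ Set.range (fun j => S.X (Fin.natAdd n j)) ∪
    Set.range (fun j => (S.X (Fin.natAdd n j))⁻¹)

/-- The ring `ℤ[q^(±1/2)][y^(±1)]` of coefficients (in which the `y` may only quasi-commute). -/
def coeffRing (v : F) (S : QuantumSeed F n f) : Subring F :=
  Subring.closure (S.coeffGenerators v)

/-- The semiring `ℤ_{≥0}[q^(±1/2)][y^(±1)]` of non-negative coefficients. -/
def nonnegCoeffs (v : F) (S : QuantumSeed F n f) : Subsemiring F :=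
  Subsemiring.closure (S.coeffGenerators v)

/-- The quantum cluster algebra: the subring generated by the coefficients and all cluster
variables. -/
def clusterAlgebra (v : F) (S : QuantumSeed F n f) : Subring F :=
  Subring.closure ((S.coeffRing v : Set F) ∪ S.clusterVariables v)

end QuantumSeed

section Basis

variable {F : Type*} [DivisionRing F]

/-- `S` is a basis of `A` as a left module over `R`. -/
def IsLeftBasis (R A : Subring F) (S : Set F) : Prop :=
  LinearIndependent R ((↑) : S → F) ∧ (Submodule.span R S : Set F) = A

/-- `S` is a basis of `A` as a right module over `R`. -/
def IsRightBasis (R A : Subring F) (S : Set F) : Prop :=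
  LinearIndependent R.op ((↑) : S → F) ∧ (Submodule.span R.op S : Set F) = A

/-- The product of any two elements of `S` is a left linear combination of elements of `S` with
coefficients in `P`. For a left basis these coefficients are the structure constants. -/
def LeftStructureConstantsIn (P : Subsemiring F) (S : Set F) : Prop :=
  ∀ s ∈ S, ∀ t ∈ S, ∃ c : S →₀ F, (∀ u, c u ∈ P) ∧ s * t = c.sum fun u r => r * (u : F)

/-- The product of any two elements of `S` is a right linear combination of elements of `S` with
coefficients in `P`. For a right basis these coefficients are the structure constants. -/
def RightStructureConstantsIn (P : Subsemiring F) (S : Set F) : Prop :=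
  ∀ s ∈ S, ∀ t ∈ S, ∃ c : S →₀ F, (∀ u, c u ∈ P) ∧ s * t = c.sum fun u r => (u : F) * r

end Basis

namespace Kronecker

/-- The quasi-commutation matrix of the Kronecker quiver with principal coefficients. -/
def Lam : Matrix (Fin (2 + 2)) (Fin (2 + 2)) ℤ :=
  !![0, 0, -1, 0; 0, 0, 0, -1; 1, 0, 0, -2; 0, 1, 2, 0]

/-- The exchange matrix of the Kronecker quiver with principal coefficients. -/
def B : Matrix (Fin (2 + 2)) (Fin 2) ℤ :=
  !![0, 2; -2, 0; 1, 0; 0, 1]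

/-- The quantum torus of the initial seed. -/
abbrev Torus := QuantumTorus Lam

/-- The skew-field of fractions of the quantum torus. -/
abbrev Frac := QuantumTorus.Frac Lam

/-- The inclusion of the quantum torus into its skew-field of fractions. -/
noncomputable def incl : Torus →+* Frac := QuantumTorus.toFrac Lam

/-- The element `q^(1/2)`. -/
noncomputable def qHalf : Frac := incl (QuantumTorus.mon 1 0)

/-- The initial quantum seed `(Λ, B̃, {X_1, X_2, y_1 = X_3, y_2 = X_4})`. -/
noncomputable def seed : QuantumSeed Frac 2 2 where
  Lam := Lam
  B := B
  X i := incl (QuantumTorus.mon 0 (Pi.single i 1))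

/-- The coefficient ring `ℤ[q^(±1/2)][y_1^(±1), y_2^(±1)]`. -/
noncomputable def coeffRing : Subring Frac := seed.coeffRing qHalf

/-- The non-negative coefficients `ℤ_{≥0}[q^(±1/2)][y_1^(±1), y_2^(±1)]`. -/
noncomputable def nonnegCoeffs : Subsemiring Frac := seed.nonnegCoeffs qHalf

/-- The Kronecker quantum cluster algebra with principal coefficients. -/
noncomputable def clusterAlgebra : Subring Frac := seed.clusterAlgebra qHalf

/-- The cluster monomials of the Kronecker quantum cluster algebra. -/
noncomputable def clusterMonomials : Set Frac := seed.clusterMonomials qHalf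

/-- The element `X_δ`, the quantum cluster character of the quasi-simple regular modules of
dimension vector `δ = (1, 1)`. -/
noncomputable def Xδ : Torus :=
  QuantumTorus.mon 0 ![1, -1, 1, 1] + QuantumTorus.mon 0 ![-1, -1, 1, 0] +
    QuantumTorus.mon 0 ![-1, 1, 0, 0]

/-- The modified Chebyshev elements of the second kind `S_n(X_δ)`, in the quantum torus. -/
noncomputable def chebTorus : ℕ → Torus
  | 0 => 1
  | 1 => Xδ
  | n + 2 => chebTorus (n + 1) * Xδ - QuantumTorus.mon 0 ![0, 0, 1, 1] * chebTorus n

/-- The modified Chebyshev elements of the second kind `S_n(X_δ)`. -/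
noncomputable def cheb (n : ℕ) : Frac := incl (chebTorus n)

/-- The set of all cluster monomials and all `S_n(X_δ)` with `n ≥ 1`. -/
noncomputable def basisS : Set Frac := clusterMonomials ∪ {x | ∃ n, 1 ≤ n ∧ x = cheb n}

/-- `x` is an element of the quantum torus which is fixed by the bar-involution. -/
def IsBarInvariant (x : Frac) : Prop := ∃ t : Torus, incl t = x ∧ QuantumTorus.bar t = t

end Kronecker

/-! Multiplying a cluster variable by a suitable square root of a frozen monomial makes it commute
with the frozen variables. What remains is the coefficient-free quantum Kronecker algebra: a
sequence `x m`, `m : ℤ`, driven by one element `z` through `z * x m = w⁻¹ x (m + 1) + w x (m - 1)`.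
The square roots are not in the torus, so the torus is embedded into itself by doubling exponents
(`phi`), and `xHat`, `zHat` live in the target. There the three-term recurrence holds by
construction, and the other relations hold because their defects do not depend on `m`
(`kroneckerRelations`).

Spanning and positivity are one argument. A product `x m * x (m + n)` is a power of `w` times a
product of two middle variables, plus a sum of `S_k` with powers of `w` as coefficients
(`mul_of_gap`). A product of `S_n` with a variable is a sum of variables (`chebS_mul`, `mul_chebS`),
and neighbouring variables quasi-commute. Hence every word straightens into the candidate basis, by
induction on its length and on the sum of the squares of its indices (`word_mem_coeffSpan`). Nothing
is subtracted, so any coefficient semiring containing the powers of `w` will do: the full ring gives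
spanning, the non-negative semiring gives the structure constants.

For independence, order exponents by `a - b`. Every basis element has a single lowest term, and the
exponents of these terms are pairwise distinct (`gVec_injective`), so a lowest term of a nontrivial
combination cannot cancel.

All this is carried back by `phiProj`, a bimodule projection onto the original torus. A basis
element differs from its normalized form by a frozen monomial, so coefficients can be moved from its
left to its right. Bar-invariance holds because the bar-involution reverses products and exchanges
the recurrences with `z` on the left and on the right.

On the side of the seeds, mutation replaces the index `i` of a cluster `{X i, X j}` by its
reflection `2 * j - i`, so the clusters are exactly the pairs of neighbours. The element `X_δ`
belongs to the algebra by a relation among `X 0`, `X 1`, `X 2`, `X 3` (`Xδ_eq`). -/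

/-! ### Product formulas in the coefficient-free Kronecker algebra -/

section KroneckerRelations

variable {k D : Type*} [CommRing k] [Ring D] [Algebra k D]

/-- The (unnormalized) Chebyshev polynomials of the second kind `S_n` evaluated at `z`. -/
def chebS (z : D) : ℕ → D
  | 0 => 1
  | 1 => z
  | n + 2 => chebS z (n + 1) * z - chebS z n

theorem chebS_commute {c z : D} (h : Commute c z) : ∀ n, Commute c (chebS z n)
  | 0 => Commute.one_right c
  | 1 => h
  | n + 2 => ((chebS_commute h (n + 1)).mul_right h).sub_right (chebS_commute h n)

theorem chebS_add_two (z : D) (n : ℕ) :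
    chebS z (n + 2) = z * chebS z (n + 1) - chebS z n := by
  rw [chebS, (chebS_commute (Commute.refl z) (n + 1)).eq]

/-- The relations of the coefficient-free quantum Kronecker cluster algebra: cluster variables
`x m`, the element `z` attached to the homogeneous tubes, and a central parameter `w`. -/
structure KroneckerRelations (w : kˣ) (z : D) (x : ℤ → D) : Prop where
  z_mul : ∀ m, z * x m = w ^ (-1 : ℤ) • x (m + 1) + w ^ (1 : ℤ) • x (m - 1)
  mul_z : ∀ m, x m * z = w ^ (1 : ℤ) • x (m + 1) + w ^ (-1 : ℤ) • x (m - 1)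
  mul_succ : ∀ m, x m * x (m + 1) = w ^ (2 : ℤ) • (x (m + 1) * x m)
  exchange : ∀ m, x m * x (m + 2) = w ^ (2 : ℤ) • (x (m + 1) * x (m + 1)) + 1
  exchange' : ∀ m, x (m + 2) * x m = w ^ (-2 : ℤ) • (x (m + 1) * x (m + 1)) + 1

/-- This is `S_n(u + u⁻¹) = u^n + u^(n-2) + ⋯ + u^(-n)`, with `u` the shift of the index scaled by
`w⁻¹`. The abstract `f` lets it serve both for left multiplication by `S_n` and, with `w⁻¹` for `w`,
for right multiplication. -/
theorem chebyshev_sum_formula (w : kˣ) (x : ℤ → D) (f : ℕ → ℤ → D) (h0 : ∀ m, f 0 m = x m)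
    (h1 : ∀ m, f 1 m = w ^ (-1 : ℤ) • x (m + 1) + w ^ (1 : ℤ) • x (m - 1))
    (h2 : ∀ n m, f (n + 2) m = w ^ (-1 : ℤ) • f (n + 1) (m + 1) + w ^ (1 : ℤ) • f (n + 1) (m - 1)
      - f n m) (n : ℕ) (m : ℤ) :
    f n m = ∑ i ∈ Finset.range (n + 1), w ^ (2 * (i : ℤ) - n) • x (m + n - 2 * i) := by
  induction n using Nat.twoStepInduction generalizing m with
  | zero => simp [h0]
  | one => simp [h1, Finset.sum_range_succ]; ring_nf
  | more n ih1 ih2 =>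
    rw [h2, ih2, ih2, ih1, Finset.sum_range_succ _ (n + 1 + 1)]
    conv_lhs => rw [Finset.sum_range_succ (fun i : ℕ =>
      w ^ (2 * (i : ℤ) - (n + 1 : ℕ)) • x (m - 1 + (n + 1 : ℕ) - 2 * i)) (n + 1)]
    simp only [smul_add, Finset.smul_sum, smul_smul, ← _root_.zpow_add]
    have e1 : ∀ i : ℕ, w ^ (-1 + (2 * (i : ℤ) - (n + 1 : ℕ))) • x (m + 1 + (n + 1 : ℕ) - 2 * i)
        = w ^ (2 * (i : ℤ) - (n + 2 : ℕ)) • x (m + (n + 2 : ℕ) - 2 * i) := by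
      intro i; congr 2 <;> push_cast <;> ring
    have e2 : ∀ i : ℕ, w ^ (1 + (2 * (i : ℤ) - (n + 1 : ℕ))) • x (m - 1 + (n + 1 : ℕ) - 2 * i)
        = w ^ (2 * (i : ℤ) - n) • x (m + n - 2 * i) := by
      intro i; congr 2 <;> push_cast <;> ring
    simp only [e1, e2]
    -- The second sum repeats `f n m`, which is subtracted, plus this one extra summand, the last
    -- term of the new sum.
    have e3 : w ^ (2 * ((n + 1 : ℕ) : ℤ) - n) • x (m + n - 2 * (n + 1 : ℕ)) =
        w ^ (2 * ((n + 1 + 1 : ℕ) : ℤ) - (n + 2 : ℕ)) • x (m + (n + 2 : ℕ) - 2 * (n + 1 + 1 : ℕ)) := by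
      congr 2 <;> push_cast <;> ring
    rw [e3]
    abel

namespace KroneckerRelations

variable {w : kˣ} {z : D} {x : ℤ → D}

/-- The symmetry `m ↦ -m` interchanges the two exchange relations; it reduces products with
decreasing indices to increasing ones. -/
theorem reflect (H : KroneckerRelations w z x) :
    KroneckerRelations w⁻¹ z (fun m => x (-m)) where
  z_mul m := by
    rw [H.z_mul, show -(m + 1) = -m - 1 by ring, show -(m - 1) = -m + 1 by ring, add_comm]; simp
  mul_z m := by
    rw [H.mul_z, show -(m + 1) = -m - 1 by ring, show -(m - 1) = -m + 1 by ring, add_comm]; simp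
  mul_succ m := by
    have := H.mul_succ (-(m + 1))
    rw [show -(m + 1) + 1 = -m by ring] at this
    rw [this, smul_smul]; simp
  exchange m := by
    have := H.exchange' (-(m + 2))
    rw [show -(m + 2) + 2 = -m by ring, show -(m + 2) + 1 = -(m + 1) by ring] at this
    rw [this]; simp
  exchange' m := by
    have := H.exchange (-(m + 2))
    rw [show -(m + 2) + 2 = -m by ring, show -(m + 2) + 1 = -(m + 1) by ring] at this
    rw [this]; simp

theorem chebS_mul (H : KroneckerRelations w z x) (n : ℕ) (m : ℤ) : chebS z n * x m =
    ∑ i ∈ Finset.range (n + 1), w ^ (2 * (i : ℤ) - n) • x (m + n - 2 * i) :=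
  chebyshev_sum_formula w x (fun n m => chebS z n * x m) (by simp [chebS])
    (by simp [chebS, H.z_mul])
    (by intro n m
        simp only [chebS, sub_mul, mul_assoc, H.z_mul, mul_add, mul_smul_comm]) n m

theorem mul_chebS (H : KroneckerRelations w z x) (n : ℕ) (m : ℤ) : x m * chebS z n =
    ∑ i ∈ Finset.range (n + 1), w⁻¹ ^ (2 * (i : ℤ) - n) • x (m + n - 2 * i) :=
  chebyshev_sum_formula w⁻¹ x (fun n m => x m * chebS z n) (by simp [chebS])
    (by simp [chebS, H.mul_z])
    (by intro n m
        simp only [chebS_add_two, mul_sub, ← mul_assoc, H.mul_z, add_mul, smul_mul_assoc]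
        simp) n m

end KroneckerRelations

/-- The part of `x m * x (m + n)` which is a combination of the `S_k`. -/
def chebTail (w : kˣ) (z : D) : ℕ → D
  | 0 => 0
  | 1 => 0
  | n + 2 => w ^ (-(n : ℤ)) • chebS z n + w ^ (2 : ℤ) • chebTail w z n

/-- The tails must satisfy the recurrence that results from eliminating `x m` from `x m * x (m +
n)`. The constant in the even case is the `1` of the exchange relation. -/
theorem chebTail_recurrence (w : kˣ) (z : D) (j : ℕ) :
    chebTail w z (2 * j + 2) = w ^ (-1 : ℤ) • (z * chebTail w z (2 * j + 1)) -
      w ^ (-2 : ℤ) • chebTail w z (2 * j) + w ^ (2 * j : ℤ) • 1 ∧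
    chebTail w z (2 * j + 3) = w ^ (-1 : ℤ) • (z * chebTail w z (2 * j + 2)) -
      w ^ (-2 : ℤ) • chebTail w z (2 * j + 1) := by
  induction j with
  | zero => simp [chebTail, chebS]
  | succ j ih =>
    -- The defect of the recurrence is multiplied by `w ^ 2` when `n` grows by two.
    have key : ∀ n : ℕ, chebTail w z (n + 4) = w ^ (-1 : ℤ) • (z * chebTail w z (n + 3)) -
      w ^ (-2 : ℤ) • chebTail w z (n + 2) + w ^ (2 : ℤ) • (chebTail w z (n + 2) -
      (w ^ (-1 : ℤ) • (z * chebTail w z (n + 1)) - w ^ (-2 : ℤ) • chebTail w z n)) := by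
      intro n
      rw [chebTail, chebS_add_two, show chebTail w z (n + 3) = _ from chebTail.eq_3 w z (n + 1),
        show chebTail w z (n + 2) = _ from chebTail.eq_3 w z n]
      simp only [mul_add, smul_sub, smul_add, mul_smul_comm, smul_smul, ← _root_.zpow_add]
      push_cast
      ring_nf
      abel
    constructor
    · rw [show 2 * (j + 1) + 2 = 2 * j + 4 by ring, key (2 * j), show 2 * (j + 1) + 1 = 2 * j + 3
        by ring, show 2 * (j + 1) = 2 * j + 2 by ring]
      congr 1
      nth_rw 1 [ih.1]
      rw [add_sub_cancel_left, smul_smul, ← _root_.zpow_add]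
      push_cast; ring_nf
    · rw [show 2 * (j + 1) + 3 = 2 * j + 1 + 4 by ring, key (2 * j + 1)]
      have h := sub_eq_zero.2 ih.2
      simp only [Nat.mul_succ, Nat.add_assoc, Nat.reduceAdd] at h ⊢
      rw [h, smul_zero, add_zero]

namespace KroneckerRelations

variable {w : kˣ} {z : D} {x : ℤ → D}

theorem eq_z_mul_sub (H : KroneckerRelations w z x) (m : ℤ) :
    x m = w ^ (-1 : ℤ) • (z * x (m + 1)) - w ^ (-2 : ℤ) • x (m + 2) := by
  rw [H.z_mul, show m + 1 + 1 = m + 2 by ring, show m + 1 - 1 = m by ring, smul_add, smul_smul,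
    smul_smul, ← _root_.zpow_add, ← _root_.zpow_add]
  simp

/-- Writing `x m` through `z * x (m + 1)` and `x (m + 2)` shortens the gap by one and by two. Then
`z` acts on the middle pair, where one term cancels. For even gaps the exchange relation then
applies; for odd gaps the cancellation needs the quasi-commutation of neighbours. -/
theorem mul_of_gap (H : KroneckerRelations w z x) (j : ℕ) : ∀ m : ℤ,
    x m * x (m + 2 * j) = w ^ (2 * j : ℤ) • (x (m + j) * x (m + j)) + chebTail w z (2 * j) ∧
    x m * x (m + 2 * j + 1) =
      w ^ (2 * j : ℤ) • (x (m + j) * x (m + j + 1)) + chebTail w z (2 * j + 1) := by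
  induction j with
  | zero => simp [chebTail]
  | succ j ih =>
    have he : ∀ m : ℤ, x m * x (m + 2 * (j + 1 : ℕ)) =
        w ^ (2 * (j + 1 : ℕ) : ℤ) • (x (m + (j + 1 : ℕ)) * x (m + (j + 1 : ℕ))) +
          chebTail w z (2 * (j + 1)) := by
      intro m
      have h1 := (ih (m + 1)).2
      have h2 := (ih (m + 2)).1
      rw [show m + 1 + 2 * (j : ℤ) + 1 = m + 2 * (j + 1 : ℕ) by push_cast; ring,
        show m + 1 + (j : ℤ) + 1 = m + j + 2 by ring] at h1
      rw [show m + 2 + 2 * (j : ℤ) = m + 2 * (j + 1 : ℕ) by push_cast; ring,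
        show m + 2 + (j : ℤ) = m + j + 2 by ring] at h2
      have h3 := H.z_mul (m + j + 1)
      rw [show m + (j : ℤ) + 1 + 1 = m + j + 2 by ring,
        show m + (j : ℤ) + 1 - 1 = m + j by ring] at h3
      rw [H.eq_z_mul_sub m, sub_mul, smul_mul_assoc, smul_mul_assoc, mul_assoc, h1, h2,
        show 2 * (j + 1) = 2 * j + 2 by ring, (chebTail_recurrence w z j).1, mul_add,
        mul_smul_comm, ← mul_assoc, show m + 1 + (j : ℤ) = m + j + 1 by ring, h3, add_mul,
        smul_mul_assoc, smul_mul_assoc, H.exchange (m + j),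
        show m + ((j + 1 : ℕ) : ℤ) = m + j + 1 by push_cast; ring]
      simp only [smul_add, smul_smul, ← _root_.zpow_add]
      push_cast
      ring_nf
      abel
    refine fun m => ⟨he m, ?_⟩
    have h1 := he (m + 1)
    have h2 := (ih (m + 2)).2
    rw [show m + 1 + 2 * ((j + 1 : ℕ) : ℤ) = m + 2 * (j + 1 : ℕ) + 1 by ring,
      show m + 1 + ((j + 1 : ℕ) : ℤ) = m + j + 2 by push_cast; ring] at h1
    rw [show m + 2 + 2 * (j : ℤ) + 1 = m + 2 * (j + 1 : ℕ) + 1 by push_cast; ring,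
      show m + 2 + (j : ℤ) + 1 = m + j + 2 + 1 by ring, show m + 2 + (j : ℤ) = m + j + 2 by ring,
      H.mul_succ] at h2
    have h3 := H.z_mul (m + j + 2)
    rw [show m + (j : ℤ) + 2 - 1 = m + j + 1 by ring] at h3
    rw [H.eq_z_mul_sub m, sub_mul, smul_mul_assoc, smul_mul_assoc, mul_assoc, h1, h2,
      show 2 * (j + 1) + 1 = 2 * j + 3 by ring, (chebTail_recurrence w z j).2, mul_add,
      mul_smul_comm, ← mul_assoc, h3, add_mul, smul_mul_assoc, smul_mul_assoc,
      show m + ((j + 1 : ℕ) : ℤ) = m + j + 1 by push_cast; ring,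
      show m + (j : ℤ) + 1 + 1 = m + j + 2 by ring, show 2 * (j + 1) = 2 * j + 2 by ring]
    simp only [smul_add, smul_smul, ← _root_.zpow_add]
    push_cast
    ring_nf
    abel

end KroneckerRelations

end KroneckerRelations

/-! ### Straightening words with subtraction-free coefficients -/

section Straightening

variable {k D : Type*} [CommRing k] [Ring D] [Algebra k D]

/-- The combinations of the family `u` with left coefficients in `K`. -/
def coeffSpan {ι : Type*} (K : Subsemiring D) (u : ι → D) : AddSubmonoid D :=
  AddSubmonoid.closure {t | ∃ c ∈ K, ∃ i, t = c * u i}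

theorem mul_mem_coeffSpan {ι : Type*} {K : Subsemiring D} {u : ι → D} {c : D} (hc : c ∈ K) (i : ι) :
    c * u i ∈ coeffSpan K u := AddSubmonoid.subset_closure ⟨c, hc, i, rfl⟩

theorem mem_coeffSpan {ι : Type*} {K : Subsemiring D} {u : ι → D} (i : ι) :
    u i ∈ coeffSpan K u := by simpa using mul_mem_coeffSpan (u := u) K.one_mem i

theorem coeffSpan_mul_left {ι : Type*} {K : Subsemiring D} {u : ι → D} {c t : D} (hc : c ∈ K)
    (ht : t ∈ coeffSpan K u) : c * t ∈ coeffSpan K u := by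
  induction ht using AddSubmonoid.closure_induction with
  | mem t ht =>
    obtain ⟨d, hd, i, rfl⟩ := ht
    rw [← mul_assoc]
    exact mul_mem_coeffSpan (K.mul_mem hc hd) i
  | zero => simp
  | add a b _ _ ha hb => rw [mul_add]; exact add_mem ha hb

theorem coeffSpan_le {ι : Type*} {K : Subsemiring D} {u : ι → D} {P : AddSubmonoid D}
    (h : ∀ c ∈ K, ∀ i, c * u i ∈ P) : coeffSpan K u ≤ P :=
  AddSubmonoid.closure_le.2 (by rintro _ ⟨c, hc, i, rfl⟩; exact h c hc i)

theorem coeffSpan_eq_finsupp_sum {ι : Type*} {K : Subsemiring D} {u : ι → D} {t : D}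
    (ht : t ∈ coeffSpan K u) : ∃ c : ι →₀ D, (∀ i, c i ∈ K) ∧ t = c.sum fun i r => r * u i := by
  classical
  induction ht using AddSubmonoid.closure_induction with
  | mem t ht =>
    obtain ⟨d, hd, i, rfl⟩ := ht
    refine ⟨Finsupp.single i d, fun j => ?_, by simp⟩
    rw [Finsupp.single_apply]
    split_ifs
    exacts [hd, K.zero_mem]
  | zero => exact ⟨0, fun _ => K.zero_mem, by simp⟩
  | add a b _ _ ha hb =>
    obtain ⟨c, hc, rfl⟩ := ha
    obtain ⟨d, hd, rfl⟩ := hb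
    refine ⟨c + d, fun i => K.add_mem (hc i) (hd i), ?_⟩
    rw [Finsupp.sum_add_index' (by simp) (by simp [add_mul])]

/-- The candidate basis of the Kronecker cluster algebra: the cluster monomials
`x m ^ (a + 1) * x (m + 1) ^ b` and the `S_n`. -/
def kroneckerBasis (z : D) (x : ℤ → D) : (ℤ × ℕ × ℕ) ⊕ ℕ → D
  | Sum.inl (m, a, b) => x m ^ (a + 1) * x (m + 1) ^ b
  | Sum.inr n => chebS z n

/-- The product of a list of cluster variables. -/
def word (x : ℤ → D) (l : List ℤ) : D := (l.map x).prod

@[simp] theorem word_nil (x : ℤ → D) : word x [] = 1 := rfl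
@[simp] theorem word_cons (x : ℤ → D) (i : ℤ) (l : List ℤ) :
    word x (i :: l) = x i * word x l := by simp [word]
@[simp] theorem word_append (x : ℤ → D) (l l' : List ℤ) :
    word x (l ++ l') = word x l * word x l' := by simp [word]
@[simp] theorem word_replicate (x : ℤ → D) (n : ℕ) (i : ℤ) :
    word x (List.replicate n i) = x i ^ n := by simp [word]

/-- Two lists which agree up to order and whose words agree up to a power of `w`. -/
def WordEquiv (w : kˣ) (x : ℤ → D) (l l' : List ℤ) : Prop :=
  l.Perm l' ∧ ∃ n : ℤ, word x l = w ^ n • word x l'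

namespace WordEquiv

variable {w : kˣ} {x : ℤ → D}

theorem refl (l : List ℤ) : WordEquiv w x l l := ⟨List.Perm.refl l, 0, by simp⟩

theorem trans {l₁ l₂ l₃ : List ℤ} (h : WordEquiv w x l₁ l₂) (h' : WordEquiv w x l₂ l₃) :
    WordEquiv w x l₁ l₃ := by
  obtain ⟨p, n, e⟩ := h
  obtain ⟨p', n', e'⟩ := h'
  exact ⟨p.trans p', n + n', by rw [e, e', smul_smul, _root_.zpow_add]⟩

theorem cons {l l' : List ℤ} (i : ℤ) (h : WordEquiv w x l l') :
    WordEquiv w x (i :: l) (i :: l') := by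
  obtain ⟨p, n, e⟩ := h
  exact ⟨p.cons i, n, by rw [word_cons, word_cons, e, mul_smul_comm]⟩

end WordEquiv

namespace KroneckerRelations

variable {w : kˣ} {z : D} {x : ℤ → D}

theorem wordEquiv_swap (H : KroneckerRelations w z x) {i j : ℤ} (h : j = i + 1 ∨ i = j + 1)
    (l : List ℤ) : WordEquiv w x (i :: j :: l) (j :: i :: l) := by
  refine ⟨List.Perm.swap j i l, ?_⟩
  simp only [word_cons, ← mul_assoc]
  rcases h with rfl | rfl
  · exact ⟨2, by rw [H.mul_succ, smul_mul_assoc]⟩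
  · exact ⟨-2, by rw [H.mul_succ j, smul_mul_assoc, smul_smul, ← _root_.zpow_add]; simp⟩

theorem wordEquiv_replicate (H : KroneckerRelations w z x) {i j : ℤ} (h : j = i + 1 ∨ i = j + 1)
    (n : ℕ) (l : List ℤ) :
    WordEquiv w x (i :: (List.replicate n j ++ l)) (List.replicate n j ++ i :: l) := by
  induction n with
  | zero => exact WordEquiv.refl _
  | succ n ih =>
    rw [List.replicate_succ, List.cons_append, List.cons_append]
    exact (H.wordEquiv_swap h _).trans (ih.cons j)

/-- Insertion sort: a new letter can be moved past neighbouring indices at the cost of a power of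
`w`, so it either completes a cluster monomial or meets a letter at distance at least two. -/
theorem word_dichotomy (H : KroneckerRelations w z x) (l : List ℤ) :
    ∃ l', WordEquiv w x l l' ∧
      (l' = [] ∨
        (∃ m a b, l' = List.replicate (a + 1) m ++ List.replicate b (m + 1)) ∨
        ∃ p i j q, l' = p ++ i :: j :: q ∧ (i + 2 ≤ j ∨ j + 2 ≤ i)) := by
  induction l with
  | nil => exact ⟨[], WordEquiv.refl _, Or.inl rfl⟩
  | cons i l ih =>
    obtain ⟨l', h, rfl | ⟨m, a, b, rfl⟩ | ⟨p, i', j', q, rfl, hij⟩⟩ := ih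
    · exact ⟨[i], h.cons i, Or.inr (Or.inl ⟨i, 0, 0, rfl⟩)⟩
    · obtain hi | rfl | rfl | rfl | hi : i + 2 ≤ m ∨ i = m - 1 ∨ i = m ∨ i = m + 1 ∨ m + 2 ≤ i := by
        omega
      · exact ⟨_, h.cons i, Or.inr (Or.inr ⟨[], i, m, _, rfl, Or.inl hi⟩)⟩
      · cases b with
        | zero =>
          refine ⟨_, h.cons _, Or.inr (Or.inl ⟨m - 1, 0, a + 1, ?_⟩)⟩
          simp
        | succ b =>
          -- Moving `m - 1` past all letters `m` puts it next to `m + 1`, which creates a gap of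
          -- two.
          refine ⟨_, (h.cons _).trans (H.wordEquiv_replicate (by omega) _ _),
            Or.inr (Or.inr ⟨_, m - 1, m + 1, List.replicate b (m + 1), rfl, by omega⟩)⟩
      · refine ⟨_, h.cons i, Or.inr (Or.inl ⟨i, a + 1, b, rfl⟩)⟩
      · exact ⟨_, (h.cons _).trans (H.wordEquiv_replicate (by omega) _ _),
          Or.inr (Or.inl ⟨m, a, b + 1, by rw [List.replicate_succ (n := b)]⟩)⟩
      · exact ⟨_, h.cons i, Or.inr (Or.inr ⟨[], i, m, _, rfl, Or.inr hi⟩)⟩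
    · exact ⟨_, h.cons i, Or.inr (Or.inr ⟨i :: p, i', j', q, rfl, hij⟩)⟩

/-- The combinations of the `S_n` with powers of `w` as coefficients. -/
def chebCone (w : kˣ) (z : D) : AddSubmonoid D :=
  AddSubmonoid.closure {t | ∃ (n : ℤ) (j : ℕ), t = w ^ n • chebS z j}

theorem smul_mem_chebCone {t : D} (ht : t ∈ chebCone w z) (n : ℤ) : w ^ n • t ∈ chebCone w z := by
  induction ht using AddSubmonoid.closure_induction with
  | mem t ht =>
    obtain ⟨m, j, rfl⟩ := ht
    exact AddSubmonoid.subset_closure ⟨n + m, j, by rw [smul_smul, _root_.zpow_add]⟩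
  | zero => simp
  | add a b _ _ ha hb => rw [smul_add]; exact add_mem ha hb

/-- Positivity enters here: the recursion of the tail contains only sums and powers of `w`. -/
theorem chebTail_mem (w : kˣ) (z : D) : ∀ n, chebTail w z n ∈ chebCone w z
  | 0 => zero_mem _
  | 1 => zero_mem _
  | n + 2 => add_mem (AddSubmonoid.subset_closure ⟨_, _, rfl⟩)
      (smul_mem_chebCone (chebTail_mem w z n) 2)

theorem chebCone_inv (w : kˣ) (z : D) : chebCone w⁻¹ z = chebCone w z := by
  unfold chebCone
  congr 1
  ext t
  constructor <;> rintro ⟨n, j, rfl⟩ <;> exact ⟨-n, j, by simp⟩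

/-- Moving two indices towards their midpoint keeps their sum and lowers the sum of their squares,
the measure on which straightening terminates. -/
theorem mul_of_add_two_le (H : KroneckerRelations w z x) {i j : ℤ} (h : i + 2 ≤ j) :
    ∃ i' j' : ℤ, i' ^ 2 + j' ^ 2 < i ^ 2 + j ^ 2 ∧ ∃ n : ℤ, ∃ t ∈ chebCone w z,
      x i * x j = w ^ n • (x i' * x j') + t := by
  obtain ⟨d, hd⟩ : ∃ d : ℕ, j = i + d := ⟨(j - i).toNat, by omega⟩
  obtain ⟨c, rfl | rfl⟩ := Nat.even_or_odd' d
  · obtain rfl : j = i + 2 * c := by rw [hd]; push_cast; ring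
    refine ⟨i + c, i + c, ?_, _, _, chebTail_mem w z _, (H.mul_of_gap c i).1⟩
    have : (1 : ℤ) ≤ c := by omega
    nlinarith
  · obtain rfl : j = i + 2 * c + 1 := by rw [hd]; push_cast; ring
    refine ⟨i + c, i + c + 1, ?_, _, _, chebTail_mem w z _, (H.mul_of_gap c i).2⟩
    have : (1 : ℤ) ≤ c := by omega
    nlinarith

theorem mul_of_gap_two_le (H : KroneckerRelations w z x) {i j : ℤ} (h : i + 2 ≤ j ∨ j + 2 ≤ i) :
    ∃ i' j' : ℤ, i' ^ 2 + j' ^ 2 < i ^ 2 + j ^ 2 ∧ ∃ n : ℤ, ∃ t ∈ chebCone w z,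
      x i * x j = w ^ n • (x i' * x j') + t := by
  rcases h with h | h
  · exact H.mul_of_add_two_le h
  · obtain ⟨i', j', hlt, n, t, ht, e⟩ := H.reflect.mul_of_add_two_le (i := -i) (j := -j) (by omega)
    refine ⟨-i', -j', by nlinarith, -n, t, chebCone_inv w z ▸ ht, ?_⟩
    simpa using e

variable {K : Subsemiring D}

/-- The combinations of words of length `n`. -/
def wordSpan (K : Subsemiring D) (x : ℤ → D) (n : ℕ) : AddSubmonoid D :=
  coeffSpan K fun l : {l : List ℤ // l.length = n} => word x l

theorem word_mem_wordSpan {l : List ℤ} {n : ℕ} (h : l.length = n) : word x l ∈ wordSpan K x n :=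
  mem_coeffSpan (K := K) (u := fun l : {l : List ℤ // l.length = n} => word x l) ⟨l, h⟩

theorem smul_mem_coeffSpan {ι : Type*} {u : ι → D} (hw : ∀ n : ℤ, w ^ n • (1 : D) ∈ K) {t : D}
    (ht : t ∈ coeffSpan K u) (n : ℤ) : w ^ n • t ∈ coeffSpan K u := by
  have := coeffSpan_mul_left (hw n) ht
  rwa [smul_mul_assoc, one_mul] at this

/-- An adjacent variable absorbs `S_n` and becomes a sum of single variables, so the length of the
word does not change. A variable must be present on one of the two sides. -/
theorem word_mul_chebS_mul_word (H : KroneckerRelations w z x) (hw : ∀ n : ℤ, w ^ n • (1 : D) ∈ K)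
    (p q : List ℤ) (n : ℕ) (h : 0 < p.length + q.length) :
    word x p * chebS z n * word x q ∈ wordSpan K x (p.length + q.length) := by
  cases q with
  | cons i q =>
    rw [word_cons, mul_assoc, ← mul_assoc (chebS z n), H.chebS_mul, Finset.sum_mul, Finset.mul_sum]
    refine sum_mem fun e _ => ?_
    rw [smul_mul_assoc, mul_smul_comm]
    refine smul_mem_coeffSpan hw ?_ _
    rw [← word_cons, ← word_append]
    exact word_mem_wordSpan (by simp)
  | nil =>
    obtain rfl | ⟨p, i, rfl⟩ := List.eq_nil_or_concat p
    · simp at h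
    · rw [List.concat_eq_append, word_append, word_cons, word_nil, mul_one, mul_one, mul_assoc,
        H.mul_chebS, Finset.mul_sum]
      refine sum_mem fun e _ => ?_
      rw [mul_smul_comm, _root_.inv_zpow']
      refine smul_mem_coeffSpan hw ?_ _
      rw [show word x p * x (i + n - 2 * e) = word x (p ++ [i + n - 2 * e]) by simp]
      exact word_mem_wordSpan (by simp)

/-- Resolving a gap leaves one word of the same length with a smaller sum of squares, and terms in
which two letters have become an `S_r`. In the latter `S_r` is absorbed, which gives words shorter
by two, unless `S_r` stands alone and is a basis element. -/
theorem word_mem_coeffSpan (H : KroneckerRelations w z x) (hw : ∀ n : ℤ, w ^ n • (1 : D) ∈ K)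
    (l : List ℤ) : word x l ∈ coeffSpan K (kroneckerBasis z x) := by
  induction hn : l.length using Nat.strong_induction_on generalizing l with
  | _ N ihN =>
  induction hs : (l.map fun i => i.natAbs ^ 2).sum using Nat.strong_induction_on
    generalizing l with
  | _ s ihs =>
  obtain ⟨l', ⟨hp, n, e⟩, h⟩ := H.word_dichotomy l
  rw [e]
  refine smul_mem_coeffSpan hw ?_ _
  obtain rfl | ⟨m, a, b, rfl⟩ | ⟨p, i, j, q, rfl, hij⟩ := h
  · exact mem_coeffSpan (u := kroneckerBasis z x) (Sum.inr 0)
  · simpa [kroneckerBasis] using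
      mem_coeffSpan (K := K) (u := kroneckerBasis z x) (Sum.inl (m, a, b))
  · obtain ⟨i', j', hlt, n', t, ht, e'⟩ := H.mul_of_gap_two_le hij
    have hlen := hp.length_eq
    have hsum := (hp.map fun i => i.natAbs ^ 2).sum_eq
    have hw1 : word x (p ++ i :: j :: q) = w ^ n' • word x (p ++ i' :: j' :: q) +
        word x p * t * word x q := by
      simp only [word_append, word_cons, ← mul_assoc]
      rw [mul_assoc (word x p) (x i), e', mul_add, add_mul, mul_smul_comm, smul_mul_assoc,
        ← mul_assoc]
    rw [hw1]
    clear hw1 e'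
    refine add_mem (smul_mem_coeffSpan hw ?_ _) ?_
    · refine ihs _ ?_ _ ?_ rfl
      · rw [← hs, hsum]
        simp only [List.map_append, List.map_cons, List.sum_append, List.sum_cons]
        have : i'.natAbs ^ 2 + j'.natAbs ^ 2 < i.natAbs ^ 2 + j.natAbs ^ 2 := by
          zify; simpa using hlt
        omega
      · simp at hlen ⊢; omega
    · induction ht using AddSubmonoid.closure_induction with
      | mem t ht =>
        obtain ⟨n'', r, rfl⟩ := ht
        rw [mul_smul_comm, smul_mul_assoc]
        refine smul_mem_coeffSpan hw ?_ _
        rcases Nat.eq_zero_or_pos (p.length + q.length) with h0 | h0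
        · obtain ⟨rfl, rfl⟩ : p = [] ∧ q = [] := by
            simpa using h0
          simpa [kroneckerBasis] using
            mem_coeffSpan (K := K) (u := kroneckerBasis z x) (Sum.inr r)
        · refine coeffSpan_le ?_ (H.word_mul_chebS_mul_word hw p q r h0)
          rintro c hc ⟨l'', hl''⟩
          refine coeffSpan_mul_left hc (ihN _ ?_ _ hl'')
          simp at hlen; omega
      | zero => simp
      | add a b _ _ ha hb =>
        rw [mul_add, add_mul]
        exact add_mem ha hb

end KroneckerRelations

/-- A recursive Clebsch–Gordan rule; iterating it expands a product of two `S` into a sum of `S`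
without signs. -/
theorem chebS_succ_mul_chebS_succ (z : D) (n m : ℕ) :
    chebS z (n + 1) * chebS z (m + 1) = chebS z (n + m + 2) + chebS z n * chebS z m := by
  induction m using Nat.twoStepInduction with
  | zero => simp [chebS]
  | one => simp [chebS, mul_sub, sub_mul, ← mul_assoc]; abel
  | more m h1 h2 =>
    have e : ∀ (a : D) (m : ℕ), a * chebS z (m + 2) =
        a * chebS z (m + 1) * z - a * chebS z m := by
      intro a m; rw [chebS, mul_sub, mul_assoc]
    rw [e _ (m + 1), e (chebS z n) m, h1, h2, add_mul,
      show chebS z (n + (m + 2) + 2) = chebS z (n + (m + 1) + 2) * z - chebS z (n + m + 2) from rfl]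
    abel

namespace KroneckerRelations

variable {w : kˣ} {z : D} {x : ℤ → D} {K : Subsemiring D}

theorem chebS_mul_chebS_mem (n m : ℕ) :
    chebS z n * chebS z m ∈ coeffSpan K (kroneckerBasis z x) := by
  have h : ∀ n, chebS z n ∈ coeffSpan K (kroneckerBasis z x) := fun n =>
    mem_coeffSpan (u := kroneckerBasis z x) (Sum.inr n)
  induction n generalizing m with
  | zero => simpa [chebS] using h m
  | succ n ih =>
    cases m with
    | zero => simpa [chebS] using h (n + 1)
    | succ m => rw [chebS_succ_mul_chebS_succ]; exact add_mem (h _) (ih m)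

theorem wordSpan_le (H : KroneckerRelations w z x) (hw : ∀ n : ℤ, w ^ n • (1 : D) ∈ K) (n : ℕ) :
    wordSpan K x n ≤ coeffSpan K (kroneckerBasis z x) :=
  coeffSpan_le fun _ hc l => coeffSpan_mul_left hc (H.word_mem_coeffSpan hw l)

theorem kroneckerBasis_mul_mem (H : KroneckerRelations w z x) (hw : ∀ n : ℤ, w ^ n • (1 : D) ∈ K)
    (i j : (ℤ × ℕ × ℕ) ⊕ ℕ) : kroneckerBasis z x i * kroneckerBasis z x j ∈
      coeffSpan K (kroneckerBasis z x) := by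
  have hword : ∀ m a b, kroneckerBasis z x (Sum.inl (m, a, b)) =
      word x (List.replicate (a + 1) m ++ List.replicate b (m + 1)) := by
    intro m a b; simp [kroneckerBasis]
  obtain ⟨m, a, b⟩ | n := i <;> obtain ⟨m', a', b'⟩ | n' := j
  · rw [hword, hword, ← word_append]
    exact H.word_mem_coeffSpan hw _
  · rw [hword]
    have := H.word_mul_chebS_mul_word hw (List.replicate (a + 1) m ++ List.replicate b (m + 1)) []
      n' (by simp)
    rw [word_nil, mul_one] at this
    exact H.wordSpan_le hw _ this
  · rw [hword]
    have := H.word_mul_chebS_mul_word hw []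
      (List.replicate (a' + 1) m' ++ List.replicate b' (m' + 1)) n (by simp)
    rw [word_nil, one_mul] at this
    exact H.wordSpan_le hw _ this
  · exact chebS_mul_chebS_mem n n'

theorem commute_kroneckerBasis {c : D} (hx : ∀ m, Commute c (x m)) (hz : Commute c z) :
    ∀ i, Commute c (kroneckerBasis z x i)
  | Sum.inl (m, _, _) => ((hx m).pow_right _).mul_right ((hx _).pow_right _)
  | Sum.inr n => chebS_commute hz n

/-- The combinations of the candidate basis with coefficients in a subsemiring `K` which contains
the powers of `w` and commutes with all `x m` and `z`. -/
def basisSpan (H : KroneckerRelations w z x) (hw : ∀ n : ℤ, w ^ n • (1 : D) ∈ K)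
    (hK : ∀ c ∈ K, ∀ i, Commute c (kroneckerBasis z x i)) : Subsemiring D where
  __ := coeffSpan K (kroneckerBasis z x)
  one_mem' := mem_coeffSpan (u := kroneckerBasis z x) (Sum.inr 0)
  mul_mem' := by
    intro s t hs ht
    change s * t ∈ coeffSpan K (kroneckerBasis z x)
    replace hs : s ∈ coeffSpan K (kroneckerBasis z x) := hs
    replace ht : t ∈ coeffSpan K (kroneckerBasis z x) := ht
    induction hs using AddSubmonoid.closure_induction with
    | mem s hs =>
      obtain ⟨c, hc, i, rfl⟩ := hs
      induction ht using AddSubmonoid.closure_induction with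
      | mem t ht =>
        obtain ⟨d, hd, j, rfl⟩ := ht
        rw [mul_assoc, ← mul_assoc _ d, ← (hK d hd i).eq, mul_assoc d, ← mul_assoc]
        exact coeffSpan_mul_left (mul_mem hc hd) (H.kroneckerBasis_mul_mem hw i j)
      | zero => simp
      | add _ _ _ _ ha hb => rw [mul_add]; exact add_mem ha hb
    | zero => simp
    | add _ _ _ _ ha hb => rw [add_mul]; exact add_mem ha hb

end KroneckerRelations
end Straightening

/-- A three-term recurrence runs in both directions from two neighbours. The base is `1, 2`, the
initial cluster, whereas Chebyshev induction starts at `0, 1`; hence the shift. -/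
theorem Int.two_step_induction {P : ℤ → Prop} (h1 : P 1) (h2 : P 2)
    (hup : ∀ m, P m → P (m + 1) → P (m + 2)) (hdown : ∀ m, P (m + 1) → P (m + 2) → P m) (m : ℤ) :
    P m := by
  have h := Polynomial.Chebyshev.induct (fun n => P (n + 1)) (by simpa) (by simpa)
    (fun n ha hb => by
      rw [show (n : ℤ) + 2 + 1 = n + 1 + 2 by ring]
      exact hup _ hb ha)
    (fun n ha hb => by
      refine hdown _ ?_ ?_
      · rwa [show -(n : ℤ) - 1 + 1 + 1 = -n + 1 by ring]
      · rwa [show -(n : ℤ) - 1 + 1 + 2 = -n + 1 + 1 by ring]) (m - 1)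
  simpa using h

/-! ### A solution of the Kronecker relations inside the torus -/

namespace Kronecker

open QuantumTorus QuantumSeed

/-- The monomial `q^(r/2) X^(a,b,c,d)`. -/
noncomputable def mon4 (r a b c d : ℤ) : Torus := mon r ![a, b, c, d]

theorem dotProduct_Lam_mulVec (a b c d a' b' c' d' : ℤ) :
    (![a, b, c, d] : Fin (2 + 2) → ℤ) ⬝ᵥ (Lam *ᵥ ![a', b', c', d']) =
      -(a * c') - b * d' + c * (a' - 2 * d') + d * (b' + 2 * c') := by
  simp [Lam, dotProduct, Matrix.mulVec, Fin.sum_univ_succ]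
  ring

theorem mon4_mul (r a b c d r' a' b' c' d' : ℤ) :
    mon4 r a b c d * mon4 r' a' b' c' d' =
      mon4 (r + r' + (-(a * c') - b * d' + c * (a' - 2 * d') + d * (b' + 2 * c')))
        (a + a') (b + b') (c + c') (d + d') := by
  rw [mon4, mon4, mon4, mon, mon, mon, MonoidAlgebra.single_mul_single, one_mul]
  congr 1
  refine TorusMonomial.ext ?_ ?_
  · rw [TorusMonomial.mul_half, dotProduct_Lam_mulVec]
  · simp

theorem mon_zero_eq (r : ℤ) : (mon r 0 : Torus) = mon4 r 0 0 0 0 := by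
  rw [mon4]; congr 1; ext i; fin_cases i <;> rfl

theorem one_eq_mon4 : (1 : Torus) = mon4 0 0 0 0 0 := by
  rw [← mon_zero_eq]; rfl

theorem mon_eq_mon4 (r : ℤ) (e : Fin (2 + 2) → ℤ) : (mon r e : Torus) =
    mon4 r (e 0) (e 1) (e 2) (e 3) := by
  rw [mon4]; congr 1; ext i; fin_cases i <;> rfl

theorem torus_induction {P : Torus → Prop} (t : Torus) (h0 : P 0)
    (hadd : ∀ s t, P s → P t → P (s + t)) (hneg : ∀ t, P t → P (-t))
    (hmon : ∀ r a b c d, P (mon4 r a b c d)) : P t := by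
  induction t using MonoidAlgebra.induction_linear with
  | zero => exact h0
  | add s t hs ht => exact hadd s t hs ht
  | single m n =>
    have hm : ∀ n : ℕ, P (MonoidAlgebra.single m (n : ℤ)) := by
      intro n
      induction n with
      | zero => simpa using h0
      | succ n ih =>
        push_cast
        rw [MonoidAlgebra.single_add]
        refine hadd _ _ ih ?_
        have := hmon m.half (m.exp 0) (m.exp 1) (m.exp 2) (m.exp 3)
        rwa [← mon_eq_mon4] at this
    obtain ⟨n, rfl | rfl⟩ := n.eq_nat_or_neg
    · exact hm n
    · rw [MonoidAlgebra.single_neg]; exact hneg _ (hm n)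

theorem commute_mon4_zero (r : ℤ) (t : Torus) : Commute (mon4 r 0 0 0 0) t := by
  induction t using torus_induction with
  | h0 => exact Commute.zero_right _
  | hadd s t hs ht => exact hs.add_right ht
  | hneg t ht => exact ht.neg_right
  | hmon r' a b c d => rw [commute_iff_eq, mon4_mul, mon4_mul]; congr 1 <;> ring

/-- The fourth root of `q`, in the torus whose monomials are the square roots of the original
ones. -/
noncomputable def wUnit : (Subring.center Torus)ˣ where
  val := ⟨mon4 2 0 0 0 0, Subring.mem_center_iff.2 fun t => (commute_mon4_zero 2 t).symm.eq⟩
  inv := ⟨mon4 (-2) 0 0 0 0, Subring.mem_center_iff.2 fun t => (commute_mon4_zero (-2) t).symm.eq⟩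
  val_inv := by ext1; simp [mon4_mul, one_eq_mon4]
  inv_val := by ext1; simp [mon4_mul, one_eq_mon4]

theorem coe_wUnit_zpow (n : ℤ) :
    (((wUnit ^ n : (Subring.center Torus)ˣ) : Subring.center Torus) : Torus) =
      mon4 (2 * n) 0 0 0 0 := by
  induction n using Int.induction_on with
  | zero => simp [one_eq_mon4]
  | succ n ih =>
    rw [_root_.zpow_add_one, Units.val_mul, Subring.coe_mul, ih]
    simp only [wUnit, mon4_mul]
    congr 1
  | pred n ih =>
    rw [_root_.zpow_sub_one, Units.val_mul, Subring.coe_mul, ih]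
    simp only [wUnit, Units.inv_mk, mon4_mul]
    congr 1; ring

theorem wUnit_smul (n : ℤ) (t : Torus) : wUnit ^ n • t = mon4 (2 * n) 0 0 0 0 * t := by
  rw [← coe_wUnit_zpow]; rfl

theorem wUnit_smul_mon4 (n r a b c d : ℤ) :
    wUnit ^ n • mon4 r a b c d = mon4 (r + 2 * n) a b c d := by
  rw [wUnit_smul, mon4_mul]; congr 1 <;> ring

/-- The normalization of `X_δ` of degree zero. -/
noncomputable def zHat : Torus := mon4 0 2 (-2) 1 1 + mon4 0 (-2) (-2) 1 (-1) + mon4 0 (-2) 2 (-1) (-1)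

/-- The evaluation at `zHat` of the Chebyshev polynomial `S n`, `n : ℤ`. -/
noncomputable def sHat (n : ℤ) : Torus := Polynomial.aeval zHat (Polynomial.Chebyshev.S ℤ n)

theorem zHat_mul_sHat (n : ℤ) : zHat * sHat n = sHat (n + 1) + sHat (n - 1) := by
  rw [sHat, sHat, Polynomial.Chebyshev.S_add_one]
  simp [sHat]

/-- The normalizations of degree zero of the cluster variables. -/
noncomputable def xHat (m : ℤ) : Torus :=
  wUnit ^ m • (sHat (m - 2) * mon4 (-4) 0 2 (-1) 0 - sHat (m - 3) * mon4 (-2) 2 0 0 1)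

theorem xHat_one : xHat 1 = mon4 0 2 0 0 1 := by
  rw [xHat, sHat, sHat]
  norm_num [Polynomial.Chebyshev.S_neg_one, Polynomial.Chebyshev.S_neg_two]
  have := wUnit_smul_mon4 1 (-2) 2 0 0 1
  rw [_root_.zpow_one] at this
  rw [this]; rfl

theorem xHat_two : xHat 2 = mon4 0 0 2 (-1) 0 := by
  rw [xHat, sHat, sHat]
  norm_num [Polynomial.Chebyshev.S_neg_one]
  exact wUnit_smul_mon4 2 (-4) 0 2 (-1) 0

/-- Built into the definition: both Chebyshev sequences in `xHat` obey the untwisted recurrence, and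
the factor `w ^ m` twists it. -/
theorem zHat_mul_xHat (m : ℤ) :
    zHat * xHat m = wUnit ^ (-1 : ℤ) • xHat (m + 1) + wUnit ^ (1 : ℤ) • xHat (m - 1) := by
  simp only [xHat, mul_smul_comm, mul_sub, ← mul_assoc, zHat_mul_sHat, smul_smul,
    ← _root_.zpow_add, add_mul, smul_sub, smul_add]
  ring_nf
  abel

theorem xHat_add_two (m : ℤ) :
    xHat (m + 2) = wUnit ^ (1 : ℤ) • (zHat * xHat (m + 1)) - wUnit ^ (2 : ℤ) • xHat m := by
  rw [zHat_mul_xHat, smul_add, smul_smul, smul_smul, ← _root_.zpow_add, ← _root_.zpow_add]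
  ring_nf; simp

theorem xHat_eq (m : ℤ) :
    xHat m = wUnit ^ (-1 : ℤ) • (zHat * xHat (m + 1)) - wUnit ^ (-2 : ℤ) • xHat (m + 2) := by
  rw [zHat_mul_xHat, smul_add, smul_smul, smul_smul, ← _root_.zpow_add, ← _root_.zpow_add]
  ring_nf; simp

theorem xHat_zero : xHat 0 = mon4 0 4 (-2) 1 2 + mon4 0 0 (-2) 1 0 := by
  rw [xHat_eq]
  norm_num [xHat_one, xHat_two, zHat, mon4_mul, add_mul, wUnit_smul_mon4, smul_add,
    -Int.reduceNeg, -_root_.zpow_neg]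

theorem xHat_three : xHat 3 = mon4 0 (-2) 4 (-2) (-1) + mon4 0 (-2) 0 0 (-1) := by
  rw [show (3 : ℤ) = 1 + 2 by norm_num, xHat_add_two, show (1 : ℤ) + 1 = 2 by norm_num, xHat_one,
    xHat_two]
  simp only [zHat, mon4_mul, add_mul, smul_add, wUnit_smul_mon4]
  norm_num
  abel

theorem xHat_induction {P : Torus → Prop} (h1 : P (mon4 0 2 0 0 1)) (h2 : P (mon4 0 0 2 (-1) 0))
    (hsub : ∀ s t, P s → P t → P (s - t)) (hw : ∀ (n : ℤ) t, P t → P (wUnit ^ n • t))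
    (hz : ∀ t, P t → P (zHat * t)) (m : ℤ) : P (xHat m) := by
  induction m using Int.two_step_induction with
  | h1 => rwa [xHat_one]
  | h2 => rwa [xHat_two]
  | hup m ha hb => rw [xHat_add_two]; exact hsub _ _ (hw _ _ (hz _ hb)) (hw _ _ ha)
  | hdown m ha hb => rw [xHat_eq]; exact hsub _ _ (hw _ _ (hz _ ha)) (hw _ _ hb)

/-- Left and right multiplication by `zHat` commute, so the right-hand rule propagates along the
left-hand recurrence once it is checked at `m = 1` and `m = 2`. -/
theorem xHat_mul_zHat (m : ℤ) :
    xHat m * zHat = wUnit ^ (1 : ℤ) • xHat (m + 1) + wUnit ^ (-1 : ℤ) • xHat (m - 1) := by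
  induction m using Int.two_step_induction with
  | h1 =>
    rw [show (1 : ℤ) + 1 = 2 by norm_num, show (1 : ℤ) - 1 = 0 by norm_num, xHat_one, xHat_two,
      xHat_zero]
    simp only [zHat, mon4_mul, mul_add, smul_add, wUnit_smul_mon4]
    norm_num
    abel
  | h2 =>
    rw [show (2 : ℤ) + 1 = 3 by norm_num, show (2 : ℤ) - 1 = 1 by norm_num, xHat_one, xHat_two,
      xHat_three]
    simp only [zHat, mon4_mul, mul_add, smul_add, wUnit_smul_mon4]
    norm_num
    abel
  | hup m ha hb =>
    rw [xHat_add_two, sub_mul, smul_mul_assoc, smul_mul_assoc, mul_assoc, ha, hb, show m + 1 + 1 = m + 2 by ring,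
      show m + 2 - 1 = m + 1 by ring]
    simp only [mul_add, mul_smul_comm, zHat_mul_xHat, smul_add, smul_smul, ← _root_.zpow_add]
    ring_nf
    abel
  | hdown m ha hb =>
    rw [xHat_eq m, sub_mul, smul_mul_assoc, smul_mul_assoc, mul_assoc, ha, hb]
    simp only [mul_add, mul_smul_comm, zHat_mul_xHat, smul_add, smul_smul, ← _root_.zpow_add]
    ring_nf
    abel

theorem int_const_of_succ {α : Type*} (f : ℤ → α) (h : ∀ m, f (m + 1) = f m) (n m : ℤ) :
    f m = f n := by
  have : ∀ m, f m = f 0 := fun m => by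
    induction m using Int.induction_on with
    | zero => rfl
    | succ m ih => rw [h, ih]
    | pred m ih => rw [← ih, ← h (-m - 1), sub_add_cancel]
  rw [this m, this n]

/-- The difference of the two sides is a conserved quantity of the recurrence, so it suffices to
evaluate it on the initial cluster. The exchange relations below are proved in the same way, with
conserved value `1`. -/
theorem xHat_mul_succ (m : ℤ) :
    xHat m * xHat (m + 1) = wUnit ^ (2 : ℤ) • (xHat (m + 1) * xHat m) := by
  rw [← sub_eq_zero]
  refine (int_const_of_succ (fun m => xHat m * xHat (m + 1) -
    wUnit ^ (2 : ℤ) • (xHat (m + 1) * xHat m)) (fun m => ?_) 1 m).trans ?_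
  · have h := xHat_add_two m
    rw [show m + 1 + 1 = m + 2 by ring]
    nth_rw 1 [h]
    rw [mul_sub, mul_smul_comm, mul_smul_comm, ← mul_assoc, xHat_mul_zHat]
    simp only [add_mul, smul_mul_assoc, smul_add, smul_smul, ← _root_.zpow_add]
    ring_nf
    simp only [_root_.zpow_zero, one_smul]
    abel
  · simp only [show (1 : ℤ) + 1 = 2 by norm_num]
    rw [xHat_one, xHat_two, mon4_mul, mon4_mul, wUnit_smul_mon4, sub_eq_zero]
    norm_num

theorem xHat_exchange (m : ℤ) :
    xHat m * xHat (m + 2) = wUnit ^ (2 : ℤ) • (xHat (m + 1) * xHat (m + 1)) + 1 := by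
  rw [← sub_eq_iff_eq_add']
  refine (int_const_of_succ (fun m => xHat m * xHat (m + 2) -
    wUnit ^ (2 : ℤ) • (xHat (m + 1) * xHat (m + 1))) (fun m => ?_) 1 m).trans ?_
  · have h := xHat_add_two (m + 1)
    rw [h, mul_sub, mul_smul_comm, mul_smul_comm, ← mul_assoc, xHat_mul_zHat]
    simp only [add_mul, smul_mul_assoc, smul_add, smul_smul, ← _root_.zpow_add]
    ring_nf
    simp only [_root_.zpow_zero, one_smul]
    abel
  · simp only [show (1 : ℤ) + 1 = 2 by norm_num, show (1 : ℤ) + 2 = 3 by norm_num]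
    rw [xHat_one, xHat_two, xHat_three, mul_add]
    simp only [mon4_mul, wUnit_smul_mon4, one_eq_mon4]
    norm_num

theorem xHat_exchange' (m : ℤ) :
    xHat (m + 2) * xHat m = wUnit ^ (-2 : ℤ) • (xHat (m + 1) * xHat (m + 1)) + 1 := by
  rw [← sub_eq_iff_eq_add']
  refine (int_const_of_succ (fun m => xHat (m + 2) * xHat m -
    wUnit ^ (-2 : ℤ) • (xHat (m + 1) * xHat (m + 1))) (fun m => ?_) 1 m).trans ?_
  · have h : xHat (m + 1 + 2) = wUnit ^ (-1 : ℤ) • (xHat (m + 2) * zHat) -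
        wUnit ^ (-2 : ℤ) • xHat (m + 1) := by
      rw [xHat_mul_zHat, smul_add, smul_smul, smul_smul, ← _root_.zpow_add, ← _root_.zpow_add]
      ring_nf; simp
    rw [h, sub_mul, smul_mul_assoc, smul_mul_assoc, mul_assoc, zHat_mul_xHat]
    simp only [mul_add, mul_smul_comm, smul_add, smul_smul, ← _root_.zpow_add]
    ring_nf
    simp only [_root_.zpow_zero, one_smul]
    abel
  · simp only [show (1 : ℤ) + 1 = 2 by norm_num, show (1 : ℤ) + 2 = 3 by norm_num]
    rw [xHat_one, xHat_two, xHat_three, add_mul]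
    simp only [mon4_mul, wUnit_smul_mon4, one_eq_mon4]
    norm_num

theorem kroneckerRelations : KroneckerRelations wUnit zHat xHat :=
  ⟨zHat_mul_xHat, xHat_mul_zHat, xHat_mul_succ, xHat_exchange, xHat_exchange'⟩

/-- A monomial with exponent `(a, b, c, d)` commutes with both frozen variables when `a = 2 * d` and
`b = -2 * c`, as each term of `zHat` does. Solving for `c` and `d` requires halving `a` and `b`;
this is why square roots of the monomials are introduced. -/
theorem commute_mon4_zHat (r c d : ℤ) : Commute (mon4 r 0 0 c d) zHat := by
  rw [commute_iff_eq, zHat]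
  simp only [mul_add, add_mul, mon4_mul]
  ring_nf

theorem commute_wUnit_smul {s t : Torus} (h : Commute s t) (n : ℤ) :
    Commute s (wUnit ^ n • t) := by
  rw [commute_iff_eq, mul_smul_comm, smul_mul_assoc, h.eq]

theorem commute_mon4_xHat (r c d m : ℤ) : Commute (mon4 r 0 0 c d) (xHat m) := by
  refine xHat_induction (P := fun t => Commute (mon4 r 0 0 c d) t) ?_ ?_ ?_ ?_ ?_ m
  · rw [commute_iff_eq, mon4_mul, mon4_mul]; congr 1 <;> ring
  · rw [commute_iff_eq, mon4_mul, mon4_mul]; congr 1 <;> ring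
  · exact fun s t hs ht => hs.sub_right ht
  · exact fun n t ht => commute_wUnit_smul ht n
  · exact fun t ht => (commute_mon4_zHat r c d).mul_right ht

/-! ### Doubling of exponents and the projection back -/

/-- The endomorphism of the group of monomials which doubles the exponents. -/
def dbl : TorusMonomial Lam →* TorusMonomial Lam where
  -- The power of `q` scales by four because the form of `Λ` is bilinear.
  toFun a := ⟨4 * a.half, (2 : ℤ) • a.exp⟩
  map_one' := by ext1 <;> simp
  map_mul' a b := by
    ext1
    · simp only [TorusMonomial.mul_half, smul_dotProduct, Matrix.mulVec_smul, dotProduct_smul,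
        smul_eq_mul]
      ring
    · simp

theorem dbl_injective : Function.Injective dbl := by
  intro a b h
  have h1 := congrArg TorusMonomial.half h
  have h2 := congrArg TorusMonomial.exp h
  refine TorusMonomial.ext ?_ ?_
  · simpa [dbl] using h1
  · funext i
    simpa [dbl] using congrFun h2 i

/-- The embedding of the quantum torus into itself which sends `q^(r/2) X^e` to `q^(2r) X^(2e)`. It
allows to work with square roots of the monomials. -/
noncomputable def phi : Torus →+* Torus := MonoidAlgebra.mapDomainRingHom ℤ dbl

theorem phi_injective : Function.Injective phi := MonoidAlgebra.mapDomain_injective dbl_injective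

theorem phi_single (m : TorusMonomial Lam) (n : ℤ) :
    phi (MonoidAlgebra.single m n) = MonoidAlgebra.single (dbl m) n :=
  MonoidAlgebra.mapDomain_single

theorem phi_mon4 (r a b c d : ℤ) :
    phi (mon4 r a b c d) = mon4 (4 * r) (2 * a) (2 * b) (2 * c) (2 * d) := by
  rw [mon4, mon, phi_single, mon4, mon]
  congr 1
  refine TorusMonomial.ext rfl ?_
  ext i
  fin_cases i <;> simp [dbl]

/-- The projection which is left inverse to `phi`. -/
noncomputable def phiProj : Torus →+ Torus :=
  MonoidAlgebra.comapDomainAddMonoidHom dbl dbl_injective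

theorem phiProj_single_dbl (m : TorusMonomial Lam) (n : ℤ) :
    phiProj (MonoidAlgebra.single (dbl m) n) = MonoidAlgebra.single m n :=
  MonoidAlgebra.comapDomain_single_map _ dbl_injective _ _

theorem phiProj_single_of_notMem {m : TorusMonomial Lam} (h : m ∉ Set.range dbl) (n : ℤ) :
    phiProj (MonoidAlgebra.single m n) = 0 :=
  MonoidAlgebra.comapDomain_single_of_not_mem_range h dbl_injective

/-- The range of `dbl` is a subgroup: multiplying a monomial by an element of it does not change
whether the monomial lies in it. -/
theorem phiProj_mul_phi (t s : Torus) : phiProj (t * phi s) = phiProj t * s := by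
  induction t using MonoidAlgebra.induction_linear with
  | zero => simp
  | add a b ha hb => rw [add_mul, map_add, ha, hb, map_add, add_mul]
  | single m n =>
    induction s using MonoidAlgebra.induction_linear with
    | zero => simp
    | add a b ha hb => rw [map_add, mul_add, map_add, ha, hb, mul_add]
    | single m' n' =>
      rw [phi_single, MonoidAlgebra.single_mul_single]
      by_cases h : m ∈ Set.range dbl
      · obtain ⟨m, rfl⟩ := h
        rw [← map_mul, phiProj_single_dbl, phiProj_single_dbl, MonoidAlgebra.single_mul_single]
      · rw [phiProj_single_of_notMem h, zero_mul, phiProj_single_of_notMem]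
        rintro ⟨m'', h'⟩
        exact h ⟨m'' * m'⁻¹, by rw [map_mul, map_inv, h', mul_inv_cancel_right]⟩

theorem phiProj_phi_mul (t s : Torus) : phiProj (phi s * t) = s * phiProj t := by
  induction t using MonoidAlgebra.induction_linear with
  | zero => simp
  | add a b ha hb => rw [mul_add, map_add, ha, hb, map_add, mul_add]
  | single m n =>
    induction s using MonoidAlgebra.induction_linear with
    | zero => simp
    | add a b ha hb => rw [map_add, add_mul, map_add, ha, hb, add_mul]
    | single m' n' =>
      rw [phi_single, MonoidAlgebra.single_mul_single]
      by_cases h : m ∈ Set.range dbl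
      · obtain ⟨m, rfl⟩ := h
        rw [← map_mul, phiProj_single_dbl, phiProj_single_dbl, MonoidAlgebra.single_mul_single]
      · rw [phiProj_single_of_notMem h, mul_zero, phiProj_single_of_notMem]
        rintro ⟨m'', h'⟩
        exact h ⟨m'⁻¹ * m'', by rw [map_mul, map_inv, h', inv_mul_cancel_left]⟩

theorem phiProj_phi (s : Torus) : phiProj (phi s) = s := by
  have := phiProj_mul_phi 1 s
  rw [one_mul] at this
  rw [this, ← map_one phi]
  have h : phiProj (phi 1) = 1 := (congrArg phiProj (phi_single 1 1)).trans (phiProj_single_dbl 1 1)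
  rw [h, one_mul]

/-- This keeps the coefficient ring, and its non-negative part, stable under the projection. -/
theorem phiProj_mon4_zero (r c d : ℤ) : phiProj (mon4 r 0 0 c d) = 0 ∨
    ∃ r' c' d', phiProj (mon4 r 0 0 c d) = mon4 r' 0 0 c' d' := by
  by_cases h : (⟨r, ![0, 0, c, d]⟩ : TorusMonomial Lam) ∈ Set.range dbl
  · obtain ⟨m, hm⟩ := h
    have h0 : m.exp 0 = 0 := by simpa [dbl] using congrFun (congrArg TorusMonomial.exp hm) 0
    have h1 : m.exp 1 = 0 := by simpa [dbl] using congrFun (congrArg TorusMonomial.exp hm) 1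
    refine Or.inr ⟨m.half, m.exp 2, m.exp 3, ?_⟩
    have h := mon_eq_mon4 m.half m.exp
    rw [h0, h1] at h
    rw [← h, mon4, mon, ← hm, phiProj_single_dbl, mon]
  · exact Or.inl (phiProj_single_of_notMem h 1)

/-! ### The bar-involution -/

section Bar

theorem bar_single (m : TorusMonomial Lam) (n : ℤ) :
    bar (MonoidAlgebra.single m n : Torus) = MonoidAlgebra.single ⟨-m.half, m.exp⟩ n :=
  MonoidAlgebra.mapDomain_single

theorem bar_add (s t : Torus) : bar (s + t) = bar s + bar t := MonoidAlgebra.mapDomain_add _ _ _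

theorem bar_zero : bar (0 : Torus) = 0 := MonoidAlgebra.mapDomain_zero _

theorem bar_sub (s t : Torus) : bar (s - t) = bar s - bar t :=
  map_sub (⟨⟨bar, bar_zero⟩, bar_add⟩ : Torus →+ Torus) s t

theorem bar_mon4 (r a b c d : ℤ) : bar (mon4 r a b c d) = mon4 (-r) a b c d := bar_single _ _

theorem Lam_antisymm (e f : Fin (2 + 2) → ℤ) : e ⬝ᵥ (Lam *ᵥ f) = -(f ⬝ᵥ (Lam *ᵥ e)) := by
  have h : ∀ e : Fin (2 + 2) → ℤ, e = ![e 0, e 1, e 2, e 3] := fun e => by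
    ext i; fin_cases i <;> rfl
  rw [h e, h f, dotProduct_Lam_mulVec, dotProduct_Lam_mulVec]
  ring

/-- Reversing the order changes the sign of the `Λ`-exponent, exactly as inverting `q` does. -/
theorem bar_mul (s t : Torus) : bar (s * t) = bar t * bar s := by
  induction s using MonoidAlgebra.induction_linear with
  | zero => simp [bar_zero]
  | add a b ha hb => rw [add_mul, bar_add, ha, hb, bar_add, mul_add]
  | single m n =>
    induction t using MonoidAlgebra.induction_linear with
    | zero => simp [bar_zero]
    | add a b ha hb => rw [mul_add, bar_add, ha, hb, bar_add, add_mul]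
    | single m' n' =>
      rw [MonoidAlgebra.single_mul_single, bar_single, bar_single, bar_single,
        MonoidAlgebra.single_mul_single, mul_comm n]
      congr 1
      refine TorusMonomial.ext ?_ (add_comm _ _)
      simp only [TorusMonomial.mul_half]
      rw [Lam_antisymm]
      ring

theorem bar_one : bar (1 : Torus) = 1 := by rw [one_eq_mon4, bar_mon4, neg_zero]

theorem bar_pow {t : Torus} (h : bar t = t) (n : ℕ) : bar (t ^ n) = t ^ n := by
  induction n with
  | zero => rw [_root_.pow_zero, bar_one]
  | succ n ih => rw [_root_.pow_succ, bar_mul, ih, h, ← _root_.pow_succ', _root_.pow_succ]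

theorem bar_mul_of_commute {s t : Torus} (hs : bar s = s) (ht : bar t = t) (h : Commute s t) :
    bar (s * t) = s * t := by rw [bar_mul, hs, ht, h.eq]

theorem bar_phi (t : Torus) : bar (phi t) = phi (bar t) := by
  induction t using MonoidAlgebra.induction_linear with
  | zero => simp [bar_zero]
  | add a b ha hb => rw [map_add, bar_add, ha, hb, bar_add, map_add]
  | single m n =>
    rw [phi_single, bar_single, bar_single, phi_single]
    congr 1
    refine TorusMonomial.ext ?_ rfl
    simp [dbl]

theorem bar_wUnit_smul (n : ℤ) (t : Torus) : bar (wUnit ^ n • t) = wUnit ^ (-n) • bar t := by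
  rw [wUnit_smul, wUnit_smul, bar_mul, bar_mon4, (commute_mon4_zero _ _).eq]
  congr 2; ring

theorem bar_zHat : bar zHat = zHat := by
  simp only [zHat, bar_add, bar_mon4, neg_zero]

theorem xHat_add_two' (m : ℤ) :
    xHat (m + 2) = wUnit ^ (-1 : ℤ) • (xHat (m + 1) * zHat) - wUnit ^ (-2 : ℤ) • xHat m := by
  rw [xHat_mul_zHat, smul_add, smul_smul, smul_smul, ← _root_.zpow_add, ← _root_.zpow_add]
  ring_nf; simp

theorem xHat_eq' (m : ℤ) :
    xHat m = wUnit ^ (1 : ℤ) • (xHat (m + 1) * zHat) - wUnit ^ (2 : ℤ) • xHat (m + 2) := by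
  rw [xHat_mul_zHat, smul_add, smul_smul, smul_smul, ← _root_.zpow_add, ← _root_.zpow_add]
  ring_nf; simp

/-- The bar-involution moves `zHat` to the other side and inverts `w`; the recurrence obtained is
the one from right multiplication, with the same solution. -/
theorem bar_xHat (m : ℤ) : bar (xHat m) = xHat m := by
  induction m using Int.two_step_induction with
  | h1 => rw [xHat_one, bar_mon4, neg_zero]
  | h2 => rw [xHat_two, bar_mon4, neg_zero]
  | hup m ha hb =>
    rw [xHat_add_two, bar_sub, bar_wUnit_smul, bar_wUnit_smul, bar_mul, bar_zHat, ha, hb,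
      ← xHat_add_two, xHat_add_two']
  | hdown m ha hb =>
    rw [xHat_eq, bar_sub, bar_wUnit_smul, bar_wUnit_smul, bar_mul, bar_zHat, ha, hb,
      ← xHat_eq, neg_neg, neg_neg, ← xHat_eq']

end Bar

/-! ### Cluster variables in the original torus -/

/-- The exponent of `y_1` in the normalization factor of the cluster variable `X_m`. -/
def yA (m : ℤ) : ℤ := if 1 ≤ m then m - 1 else -m - 1

/-- The exponent of `y_2` in the normalization factor of the cluster variable `X_m`. -/
def yB (m : ℤ) : ℤ := if 1 ≤ m then m - 2 else -m

/-- The image under `phi` of the cluster variable `X_m`. -/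
noncomputable def phiX (m : ℤ) : Torus := mon4 0 0 0 (yA m) (yB m) * xHat m

theorem phi_Xδ : phi Xδ = mon4 0 0 0 1 1 * zHat := by
  have h : Xδ = mon4 0 1 (-1) 1 1 + mon4 0 (-1) (-1) 1 0 + mon4 0 (-1) 1 0 0 := rfl
  rw [h, zHat, map_add, map_add, phi_mon4, phi_mon4, phi_mon4]
  simp only [mul_add, mon4_mul]
  norm_num

theorem mon4_mul_wUnit_smul_zHat_mul (n r c d r' c' d' : ℤ) (t : Torus)
    (h : r + 2 * n = r' + 2 * (c' - d')) (hc : c = c' + 1) (hd : d = d' + 1) :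
    mon4 r 0 0 c d * wUnit ^ n • (zHat * t) = phi Xδ * (mon4 r' 0 0 c' d' * t) := by
  subst hc hd
  obtain rfl : r = r' + 2 * (c' - d') - 2 * n := by linarith
  rw [phi_Xδ, mul_assoc, ← mul_assoc zHat, ← (commute_mon4_zHat _ _ _).eq, mul_assoc,
    ← mul_assoc (mon4 0 0 0 1 1), mon4_mul, mul_smul_comm, ← smul_mul_assoc, wUnit_smul_mon4]
  congr 2 <;> ring

theorem mon4_mul_wUnit_smul_mul (n r c d s u v r' c' d' : ℤ) (t : Torus)
    (h : r + 2 * n = s + r' - 2 * (u * d' - v * c')) (hc : c = u + c') (hd : d = v + d') :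
    mon4 r 0 0 c d * wUnit ^ n • t = mon4 s 0 0 u v * (mon4 r' 0 0 c' d' * t) := by
  subst hc hd
  rw [← mul_assoc, mon4_mul, mul_smul_comm, ← smul_mul_assoc, wUnit_smul_mon4, h]
  congr 2; ring

/-- After the frozen normalization, the recurrence has all its coefficients in the range of `phi`.
The exponents `yA`, `yB` are affine in `m` only on each of the sides `m ≥ 1` and `m ≤ 0`; the step
across, from `0, 1` to `-1`, is `phiX_neg_one` and has another coefficient. -/
theorem phiX_add_two {m : ℤ} (hm : 1 ≤ m) :
    phiX (m + 2) = phi Xδ * phiX (m + 1) - phi (mon4 0 0 0 1 1) * phiX m := by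
  rw [phiX, phiX, phiX, xHat_add_two, mul_sub, phi_mon4]
  simp only [yA, yB, if_pos hm, if_pos (show 1 ≤ m + 1 by omega), if_pos (show 1 ≤ m + 2 by omega)]
  exact congrArg₂ (fun a b => a - b)
    (mon4_mul_wUnit_smul_zHat_mul _ _ _ _ _ _ _ _ (by ring) (by ring) (by ring))
    (mon4_mul_wUnit_smul_mul _ _ _ _ _ _ _ _ _ _ _ (by ring) (by ring) (by ring))

theorem phiX_sub_two {m : ℤ} (hm : m + 2 ≤ 0) :
    phiX m = phi Xδ * phiX (m + 1) - phi (mon4 0 0 0 1 1) * phiX (m + 2) := by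
  rw [phiX, phiX, phiX, xHat_eq m, mul_sub, phi_mon4]
  simp only [yA, yB, if_neg (show ¬ 1 ≤ m by omega), if_neg (show ¬ 1 ≤ m + 1 by omega),
    if_neg (show ¬ 1 ≤ m + 2 by omega)]
  exact congrArg₂ (fun a b => a - b)
    (mon4_mul_wUnit_smul_zHat_mul _ _ _ _ _ _ _ _ (by ring) (by ring) (by ring))
    (mon4_mul_wUnit_smul_mul _ _ _ _ _ _ _ _ _ _ _ (by ring) (by ring) (by ring))

theorem phiX_neg_one : phiX (-1) = phi Xδ * phiX 0 - phi (mon4 (-1) 0 0 0 1) * phiX 1 := by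
  rw [phiX, phiX, phiX, xHat_eq (-1), mul_sub, phi_mon4]
  norm_num [yA, yB, -Int.reduceNeg, -_root_.zpow_neg]
  exact congrArg₂ (fun a b => a - b)
    (mon4_mul_wUnit_smul_zHat_mul _ _ _ _ _ _ _ _ (by ring) (by ring) (by ring))
    (mon4_mul_wUnit_smul_mul _ _ _ _ _ _ _ _ _ _ _ (by ring) (by ring) (by ring))

theorem phiX_zero : phiX 0 = phi (mon4 0 2 (-1) 0 1 + mon4 0 0 (-1) 0 0) := by
  rw [phiX, xHat_zero, map_add, phi_mon4, phi_mon4, mul_add]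
  norm_num [yA, yB, mon4_mul]

theorem phiX_one : phiX 1 = phi (mon4 0 1 0 0 0) := by
  rw [phiX, xHat_one, phi_mon4]
  norm_num [yA, yB, mon4_mul]

theorem phiX_two : phiX 2 = phi (mon4 0 0 1 0 0) := by
  rw [phiX, xHat_two, phi_mon4]
  norm_num [yA, yB, mon4_mul]

/-- Thus no square root survives in the cluster variables themselves. -/
theorem phiX_mem_range (m : ℤ) : phiX m ∈ phi.range := by
  have hup : ∀ n : ℕ, phiX (n + 1) ∈ phi.range ∧ phiX (n + 2) ∈ phi.range := by
    intro n
    induction n with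
    | zero => exact ⟨by simp [phiX_one], by simp [phiX_two]⟩
    | succ n ih =>
      have h := phiX_add_two (m := n + 1) (by omega)
      push_cast
      rw [show (n : ℤ) + 1 + 1 = n + 2 by ring] at h ⊢
      refine ⟨ih.2, ?_⟩
      rw [h]
      exact sub_mem (mul_mem ⟨_, rfl⟩ ih.2) (mul_mem ⟨_, rfl⟩ ih.1)
  have h0 : phiX 0 ∈ phi.range := by rw [phiX_zero]; exact ⟨_, rfl⟩
  have hdown : ∀ n : ℕ, phiX (-n) ∈ phi.range ∧ phiX (-n - 1) ∈ phi.range := by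
    intro n
    induction n with
    | zero =>
      refine ⟨by simpa using h0, ?_⟩
      simp only [Nat.cast_zero, neg_zero, zero_sub]
      rw [phiX_neg_one, phiX_one]
      exact sub_mem (mul_mem ⟨_, rfl⟩ h0) (mul_mem ⟨_, rfl⟩ ⟨_, rfl⟩)
    | succ n ih =>
      have h := phiX_sub_two (m := -n - 2) (by omega)
      push_cast
      rw [show -(n : ℤ) - 2 + 1 = -n - 1 by ring, show -(n : ℤ) - 2 + 2 = -n by ring] at h
      rw [show -((n : ℤ) + 1) = -n - 1 by ring, show -(n : ℤ) - 1 - 1 = -n - 2 by ring]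
      refine ⟨ih.2, ?_⟩
      rw [h]
      exact sub_mem (mul_mem ⟨_, rfl⟩ ih.2) (mul_mem ⟨_, rfl⟩ ih.1)
  rcases le_or_gt 1 m with h | h
  · have := (hup (m - 1).toNat).1
    rwa [Int.toNat_of_nonneg (by omega), sub_add_cancel] at this
  · have := (hdown (-m).toNat).1
    rwa [Int.toNat_of_nonneg (by omega), neg_neg] at this

/-- The cluster variables, as elements of the quantum torus. -/
noncomputable def X (m : ℤ) : Torus := phiProj (phiX m)

theorem phi_X (m : ℤ) : phi (X m) = mon4 0 0 0 (yA m) (yB m) * xHat m := by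
  obtain ⟨t, ht⟩ := phiX_mem_range m
  rw [X, ← ht, phiProj_phi, ht, phiX]

theorem X_one : X 1 = mon4 0 1 0 0 0 := by rw [X, phiX_one, phiProj_phi]

theorem X_two : X 2 = mon4 0 0 1 0 0 := by rw [X, phiX_two, phiProj_phi]

theorem bar_X (m : ℤ) : bar (X m) = X m := by
  apply phi_injective
  rw [← bar_phi, phi_X]
  refine bar_mul_of_commute ?_ (bar_xHat m) (commute_mon4_xHat _ _ _ m)
  rw [bar_mon4, neg_zero]

/-- The factor `w ^ 2` between neighbouring `xHat` is cancelled by the quasi-commutation of the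
frozen prefactors, since `yA m * yB (m + 1) - yB m * yA (m + 1) = 1` for all `m`. -/
theorem commute_X_succ (m : ℤ) : Commute (X m) (X (m + 1)) := by
  apply phi_injective
  rw [map_mul, map_mul, phi_X, phi_X, mul_assoc, ← mul_assoc (xHat m),
    ← (commute_mon4_xHat _ _ _ m).eq, mul_assoc, ← mul_assoc (mon4 0 0 0 _ _),
    mul_assoc _ (xHat (m + 1)), ← mul_assoc (xHat (m + 1)), ← (commute_mon4_xHat _ _ _ (m + 1)).eq,
    mul_assoc _ (xHat (m + 1)), ← mul_assoc (mon4 0 0 0 _ _), mon4_mul, mon4_mul, xHat_mul_succ,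
    mul_smul_comm, ← smul_mul_assoc, wUnit_smul_mon4]
  congr 2
  · simp only [yA, yB]; split_ifs <;> first | omega | ring_nf
  all_goals ring

/-! ### Lowest terms and `g`-vectors -/

/-- The combinations of monomials `X^(a,b,c,d)` with `a - b > k`. -/
noncomputable def above (k : ℤ) : AddSubgroup Torus :=
  AddSubgroup.closure {t | ∃ r a b c d, k < a - b ∧ t = mon4 r a b c d}

theorem mon4_mem_above {k a b : ℤ} (r c d : ℤ) (h : k < a - b) : mon4 r a b c d ∈ above k :=
  AddSubgroup.subset_closure ⟨r, a, b, c, d, h, rfl⟩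

theorem above_anti {k l : ℤ} (h : k ≤ l) : above l ≤ above k :=
  AddSubgroup.closure_mono (by
    rintro _ ⟨r, a, b, c, d, h', rfl⟩; exact ⟨r, a, b, c, d, by omega, rfl⟩)

theorem mon4_mul_mem_above {k : ℤ} {t : Torus} (ht : t ∈ above k) (r a b c d : ℤ) :
    mon4 r a b c d * t ∈ above (a - b + k) := by
  induction ht using AddSubgroup.closure_induction with
  | mem t ht =>
    obtain ⟨r', a', b', c', d', h', rfl⟩ := ht
    rw [mon4_mul]
    exact mon4_mem_above _ _ _ (by linarith)
  | zero => simp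
  | add s t _ _ hs ht => rw [mul_add]; exact add_mem hs ht
  | neg t _ ht => rw [mul_neg]; exact neg_mem ht

theorem mul_mem_above {k l : ℤ} {s t : Torus} (hs : s ∈ above k) (ht : t ∈ above l) :
    s * t ∈ above (k + l + 1) := by
  induction hs using AddSubgroup.closure_induction with
  | mem s hs =>
    obtain ⟨r, a, b, c, d, h, rfl⟩ := hs
    exact above_anti (by omega) (mon4_mul_mem_above ht r a b c d)
  | zero => simp
  | add s t _ _ hs ht => rw [add_mul]; exact add_mem hs ht
  | neg t _ ht => rw [neg_mul]; exact neg_mem ht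

theorem mul_mon4_mem_above {k : ℤ} {t : Torus} (ht : t ∈ above k) (r a b c d : ℤ) :
    t * mon4 r a b c d ∈ above (k + (a - b)) := by
  have := mul_mem_above ht (mon4_mem_above (k := a - b - 1) (a := a) (b := b) r c d (by omega))
  rwa [show k + (a - b - 1) + 1 = k + (a - b) by ring] at this

/-- `t` has a leading term with exponent `(p, q, *, *)`, and all other terms are higher. -/
def Pointed (p q : ℤ) (t : Torus) : Prop := ∃ r c d, t - mon4 r p q c d ∈ above (p - q)

theorem pointed_mon4 (r p q c d : ℤ) : Pointed p q (mon4 r p q c d) := ⟨r, c, d, by simp⟩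

namespace Pointed

theorem mul {p q p' q' : ℤ} {s t : Torus} (hs : Pointed p q s) (ht : Pointed p' q' t) :
    Pointed (p + p') (q + q') (s * t) := by
  obtain ⟨r, c, d, h⟩ := hs
  obtain ⟨r', c', d', h'⟩ := ht
  suffices H : s * t - mon4 r p q c d * mon4 r' p' q' c' d' ∈ above (p + p' - (q + q')) by
    rw [mon4_mul] at H
    exact ⟨_, _, _, H⟩
  have e : s * t - mon4 r p q c d * mon4 r' p' q' c' d' =
      (s - mon4 r p q c d) * (t - mon4 r' p' q' c' d') +
      (s - mon4 r p q c d) * mon4 r' p' q' c' d' +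
      mon4 r p q c d * (t - mon4 r' p' q' c' d') := by noncomm_ring
  rw [e]
  refine add_mem (add_mem ?_ ?_) ?_
  · exact above_anti (by omega) (mul_mem_above h h')
  · exact above_anti (by omega) (mul_mon4_mem_above h _ _ _ _ _)
  · exact above_anti (by omega) (mon4_mul_mem_above h' _ _ _ _ _)

theorem one : Pointed 0 0 1 := by rw [one_eq_mon4]; exact pointed_mon4 _ _ _ _ _

theorem pow {p q : ℤ} {t : Torus} (ht : Pointed p q t) (n : ℕ) :
    Pointed (n * p) (n * q) (t ^ n) := by
  induction n with
  | zero => simpa using one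
  | succ n ih =>
    rw [_root_.pow_succ]
    convert ih.mul ht using 1 <;> push_cast <;> ring

theorem sub {p q : ℤ} {s t : Torus} (hs : Pointed p q s) (ht : t ∈ above (p - q)) :
    Pointed p q (s - t) := by
  obtain ⟨r, c, d, h⟩ := hs
  refine ⟨r, c, d, ?_⟩
  rw [sub_right_comm]
  exact sub_mem h ht

theorem mem_above {p q k : ℤ} {t : Torus} (ht : Pointed p q t) (hk : k < p - q) :
    t ∈ above k := by
  obtain ⟨r, c, d, h⟩ := ht
  rw [← sub_add_cancel t (mon4 r p q c d)]
  exact add_mem (above_anti hk.le h) (mon4_mem_above _ _ _ hk)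

theorem wUnit_smul {p q : ℤ} {t : Torus} (ht : Pointed p q t) (n : ℤ) :
    Pointed p q (wUnit ^ n • t) := by
  rw [Kronecker.wUnit_smul]
  simpa using (pointed_mon4 (2 * n) 0 0 0 0).mul ht

end Pointed

theorem pointed_zHat : Pointed (-2) 2 zHat :=
  ⟨0, -1, -1, by
    rw [zHat, add_sub_cancel_right]
    exact add_mem (mon4_mem_above _ _ _ (by norm_num)) (mon4_mem_above _ _ _ (by norm_num))⟩

/-- Multiplication by `zHat` lowers `a - b` by four, so its product with `s` supplies the lowest
term as long as `t` stays strictly above. -/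
theorem pointed_of_recurrence {p q p' q' : ℤ} {s t : Torus} (hs : Pointed p q s)
    (ht : Pointed p' q' t) (h : p - q < p' - q' + 4) (n n' : ℤ) :
    Pointed (p - 2) (q + 2) (wUnit ^ n • (zHat * s) - wUnit ^ n' • t) := by
  have h1 := ((pointed_zHat.mul hs).wUnit_smul n).sub
    ((ht.wUnit_smul n').mem_above (k := -2 + p - (2 + q)) (by omega))
  rwa [show p - 2 = -2 + p by ring, show q + 2 = 2 + q by ring]

theorem pointed_xHat (m : ℤ) : Pointed (-2 * yB m) (2 * yA m) (xHat m) := by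
  have hup : ∀ n : ℕ, Pointed (-2 * yB (n + 1)) (2 * yA (n + 1)) (xHat (n + 1)) ∧
      Pointed (-2 * yB (n + 2)) (2 * yA (n + 2)) (xHat (n + 2)) := by
    intro n
    induction n with
    | zero =>
      simp only [Nat.cast_zero, zero_add, xHat_one, xHat_two]
      exact ⟨pointed_mon4 _ _ _ _ _, pointed_mon4 _ _ _ _ _⟩
    | succ n ih =>
      push_cast
      rw [show (n : ℤ) + 1 + 1 = n + 2 by ring]
      refine ⟨ih.2, ?_⟩
      have h := pointed_of_recurrence ih.2 ih.1 (by simp only [yA, yB]; split_ifs <;> omega) 1 2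
      have e := xHat_add_two (n + 1)
      rw [show (n : ℤ) + 1 + 1 = n + 2 by ring] at e
      rw [← e] at h
      convert h using 1 <;> simp only [yA, yB] <;> split_ifs <;> omega
  -- The recurrence cannot provide this case: the lowest exponents of `zHat * xHat 1` and `xHat 2`
  -- coincide. The descent therefore starts from the pair `1, 0`.
  have h0 : Pointed (-2 * yB 0) (2 * yA 0) (xHat 0) := by
    rw [xHat_zero]
    refine ⟨0, 1, 0, ?_⟩
    simp only [yA, yB]
    norm_num
    exact mon4_mem_above _ _ _ (by norm_num)
  have hdown : ∀ n : ℕ, Pointed (-2 * yB (1 - n)) (2 * yA (1 - n)) (xHat (1 - n)) ∧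
      Pointed (-2 * yB (-n)) (2 * yA (-n)) (xHat (-n)) := by
    intro n
    induction n with
    | zero => exact ⟨by simpa using (hup 0).1, by simpa using h0⟩
    | succ n ih =>
      push_cast
      rw [show 1 - ((n : ℤ) + 1) = -n by ring]
      refine ⟨ih.2, ?_⟩
      have h := pointed_of_recurrence ih.2 ih.1 (by simp only [yA, yB]; split_ifs <;> omega)
        (-1) (-2)
      have e := xHat_eq (-(n + 1))
      rw [show -((n : ℤ) + 1) + 1 = -n by ring, show -((n : ℤ) + 1) + 2 = 1 - n by ring] at e
      rw [← e] at h
      convert h using 1 <;> simp only [yA, yB] <;> split_ifs <;> omega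
  rcases le_or_gt 1 m with h | h
  · have := (hup (m - 1).toNat).1
    rwa [Int.toNat_of_nonneg (by omega), sub_add_cancel] at this
  · have := (hdown (-m).toNat).2
    rwa [Int.toNat_of_nonneg (by omega), neg_neg] at this

theorem pointed_chebS (n : ℕ) : Pointed (-2 * n) (2 * n) (chebS zHat n) := by
  induction n using Nat.twoStepInduction with
  | zero => simpa [chebS] using Pointed.one
  | one => simpa [chebS] using pointed_zHat
  | more n h1 h2 =>
    have h := pointed_of_recurrence h2 h1 (by push_cast; omega) 0 0
    rw [_root_.zpow_zero, one_smul, one_smul, ← chebS_add_two] at h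
    convert h using 1 <;> push_cast <;> ring

/-- The (doubled) `g`-vectors of the candidate basis. -/
def gVec : (ℤ × ℕ × ℕ) ⊕ ℕ → ℤ × ℤ
  | Sum.inl (m, a, b) => ((a + 1 : ℕ) * (-2 * yB m) + b * (-2 * yB (m + 1)),
      (a + 1 : ℕ) * (2 * yA m) + b * (2 * yA (m + 1)))
  | Sum.inr n => (-2 * n, 2 * n)

theorem pointed_kroneckerBasis (i : (ℤ × ℕ × ℕ) ⊕ ℕ) :
    Pointed (gVec i).1 (gVec i).2 (kroneckerBasis zHat xHat i) := by
  obtain ⟨m, a, b⟩ | n := i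
  · exact ((pointed_xHat m).pow _).mul ((pointed_xHat _).pow _)
  · exact pointed_chebS n

theorem eq_and_eq_of_mul_add_eq {s m m' b b' : ℤ} (hb : 0 ≤ b) (hbs : b < s) (hb' : 0 ≤ b')
    (hbs' : b' < s) (h : s * m + b = s * m' + b') : m = m' ∧ b = b' := by
  have h1 : m = m' := by
    have e1 := Int.add_mul_ediv_left b m (show s ≠ 0 by omega)
    have e2 := Int.add_mul_ediv_left b' m' (show s ≠ 0 by omega)
    rw [Int.ediv_eq_zero_of_lt hb hbs, zero_add] at e1
    rw [Int.ediv_eq_zero_of_lt hb' hbs', zero_add] at e2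
    rw [← e1, ← e2, add_comm b, add_comm b', h]
  subst h1
  exact ⟨rfl, by linarith⟩

theorem gVec_inl_of_pos {m : ℤ} (hm : 1 ≤ m) (a b : ℕ) : gVec (Sum.inl (m, a, b)) =
    (2 * (a + 1 + b) - 2 * ((a + 1 + b) * (m - 1) + b), 2 * ((a + 1 + b) * (m - 1) + b)) := by
  simp only [gVec, yA, yB, if_pos hm, if_pos (show 1 ≤ m + 1 by omega)]
  refine Prod.ext ?_ ?_ <;> push_cast <;> ring

theorem gVec_inl_zero (a b : ℕ) : gVec (Sum.inl (0, a, b)) = ((2 * b, -2 * (a + 1)) : ℤ × ℤ) := by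
  simp only [gVec, yA, yB]
  refine Prod.ext ?_ ?_ <;> norm_num <;> ring

theorem gVec_inl_of_neg {m : ℤ} (hm : m ≤ -1) (a b : ℕ) : gVec (Sum.inl (m, a, b)) =
    (2 * ((a + 1 + b) * m + b), -2 * (a + 1 + b) - 2 * ((a + 1 + b) * m + b)) := by
  simp only [gVec, yA, yB, if_neg (show ¬ 1 ≤ m by omega), if_neg (show ¬ 1 ≤ m + 1 by omega)]
  refine Prod.ext ?_ ?_ <;> push_cast <;> ring

/-- Each cluster spans a cone of the `g`-vector fan, and the `S_n` lie on the limiting ray, where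
the coordinates sum to zero. For `m ≠ 0` the coordinate sum gives the sign of `m` and the number `a
+ 1 + b` of factors; division with remainder by this number recovers the index and `b`. The cluster
`0, 1` occupies the quadrant with first coordinate non-negative and second negative, which no other
case meets. -/
theorem gVec_injective : Function.Injective gVec := by
  have key : ∀ m a b m' a' b', m ≤ m' → gVec (Sum.inl (m, a, b)) = gVec (Sum.inl (m', a', b')) →
      (m, a, b) = (m', a', b') := by
    intro m a b m' a' b' hmm h
    rcases lt_trichotomy m 0 with hm | rfl | hm
    · rw [gVec_inl_of_neg (by omega)] at h
      rcases lt_trichotomy m' 0 with hm' | rfl | hm'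
      · rw [gVec_inl_of_neg (by omega), Prod.mk.injEq] at h
        have hs : (a : ℤ) + 1 + b = a' + 1 + b' := by linarith [h.1, h.2]
        have h1 : ((a : ℤ) + 1 + b) * m + b = (a + 1 + b) * m' + b' := by
          have := h.1
          rw [← hs] at this
          linarith
        obtain ⟨rfl, h2⟩ := eq_and_eq_of_mul_add_eq (by omega) (by omega) (by omega) (by omega) h1
        simp only [Prod.mk.injEq, true_and]
        omega
      · rw [gVec_inl_zero, Prod.mk.injEq] at h
        have := h.1
        nlinarith
      · rw [gVec_inl_of_pos (by omega), Prod.mk.injEq] at h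
        have := h.1
        have := h.2
        omega
    · rcases hmm.eq_or_lt with rfl | hm'
      · rw [gVec_inl_zero, gVec_inl_zero, Prod.mk.injEq] at h
        simp only [Prod.mk.injEq, true_and]
        omega
      · rw [gVec_inl_zero, gVec_inl_of_pos (by omega), Prod.mk.injEq] at h
        have := h.2
        nlinarith
    · rw [gVec_inl_of_pos (by omega), gVec_inl_of_pos (by omega), Prod.mk.injEq] at h
      have hs : (a : ℤ) + 1 + b = a' + 1 + b' := by linarith [h.1, h.2]
      have h1 : ((a : ℤ) + 1 + b) * (m - 1) + b = (a + 1 + b) * (m' - 1) + b' := by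
        have := h.2
        rw [← hs] at this
        linarith
      obtain ⟨h3, h2⟩ := eq_and_eq_of_mul_add_eq (by omega) (by omega) (by omega) (by omega) h1
      simp only [Prod.mk.injEq]
      omega
  have hne : ∀ m a b n, gVec (Sum.inl (m, a, b)) ≠ gVec (Sum.inr n) := by
    intro m a b n h
    rcases lt_trichotomy m 0 with hm | rfl | hm
    · rw [gVec_inl_of_neg (by omega), gVec, Prod.mk.injEq] at h; omega
    · rw [gVec_inl_zero, gVec, Prod.mk.injEq] at h; omega
    · rw [gVec_inl_of_pos (by omega), gVec, Prod.mk.injEq] at h; omega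
  rintro (⟨m, a, b⟩ | n) (⟨m', a', b'⟩ | n') h
  · rcases le_total m m' with hm | hm
    · rw [key _ _ _ _ _ _ hm h]
    · rw [key _ _ _ _ _ _ hm h.symm]
  · exact absurd h (hne _ _ _ _)
  · exact absurd h.symm (hne _ _ _ _)
  · simp only [gVec, Prod.mk.injEq] at h
    congr 1; omega

/-! ### Linear independence over the coefficient ring -/

/-- The part of an element of the quantum torus of degree `(p, q, *, *)`. -/
noncomputable def degPart (p q : ℤ) : Torus →+ Torus :=
  (MonoidAlgebra.coeffAddEquiv.symm.toAddMonoidHom.comp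
    (Finsupp.filterAddHom fun m : TorusMonomial Lam => m.exp 0 = p ∧ m.exp 1 = q)).comp
    MonoidAlgebra.coeffAddEquiv.toAddMonoidHom

theorem degPart_mon4_of_eq (r p q c d : ℤ) : degPart p q (mon4 r p q c d) = mon4 r p q c d := by
  have : Finsupp.filter (fun m : TorusMonomial Lam => m.exp 0 = p ∧ m.exp 1 = q)
      (Finsupp.single ⟨r, ![p, q, c, d]⟩ (1 : ℤ)) = Finsupp.single ⟨r, ![p, q, c, d]⟩ 1 :=
    Finsupp.filter_single_of_pos _ ⟨rfl, rfl⟩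
  exact congrArg MonoidAlgebra.ofCoeff this

theorem degPart_mon4_of_ne {p q a b : ℤ} (h : ¬ (a = p ∧ b = q)) (r c d : ℤ) :
    degPart p q (mon4 r a b c d) = 0 := by
  have : Finsupp.filter (fun m : TorusMonomial Lam => m.exp 0 = p ∧ m.exp 1 = q)
      (Finsupp.single ⟨r, ![a, b, c, d]⟩ (1 : ℤ)) = 0 :=
    Finsupp.filter_single_of_neg _ h
  exact congrArg MonoidAlgebra.ofCoeff this

theorem degPart_mon4_mul (p q r c d : ℤ) (t : Torus) :
    degPart p q (mon4 r 0 0 c d * t) = mon4 r 0 0 c d * degPart p q t := by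
  induction t using torus_induction with
  | h0 => simp
  | hadd s t hs ht => rw [mul_add, map_add, hs, ht, map_add, mul_add]
  | hneg t ht => rw [mul_neg, map_neg, ht, map_neg, mul_neg]
  | hmon r' a b c' d' =>
    rw [mon4_mul, zero_add, zero_add]
    by_cases h : a = p ∧ b = q
    · obtain ⟨rfl, rfl⟩ := h
      rw [degPart_mon4_of_eq, degPart_mon4_of_eq, mon4_mul, zero_add, zero_add]
    · rw [degPart_mon4_of_ne h, degPart_mon4_of_ne h, mul_zero]

theorem degPart_eq_zero_of_mem_above {p q k : ℤ} (h : p - q ≤ k) {t : Torus} (ht : t ∈ above k) :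
    degPart p q t = 0 := by
  induction ht using AddSubgroup.closure_induction with
  | mem t ht =>
    obtain ⟨r, a, b, c, d, h', rfl⟩ := ht
    exact degPart_mon4_of_ne (by omega) _ _ _
  | zero => simp
  | add s t _ _ hs ht => rw [map_add, hs, ht, add_zero]
  | neg t _ ht => rw [map_neg, ht, neg_zero]

theorem Pointed.degPart_eq {p q : ℤ} {t : Torus} (h : Pointed p q t) :
    ∃ r c d, degPart p q t = mon4 r p q c d := by
  obtain ⟨r, c, d, h⟩ := h
  have := degPart_eq_zero_of_mem_above le_rfl h
  rw [map_sub, degPart_mon4_of_eq, sub_eq_zero] at this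
  exact ⟨r, c, d, this⟩

theorem Pointed.degPart_eq_zero {p q p' q' : ℤ} {t : Torus} (h : Pointed p q t)
    (hle : p' - q' ≤ p - q) (hne : (p', q') ≠ (p, q)) : degPart p' q' t = 0 := by
  obtain ⟨r, c, d, h⟩ := h
  have := degPart_eq_zero_of_mem_above hle h
  rwa [map_sub, degPart_mon4_of_ne (fun h => hne (by rw [h.1, h.2])), sub_zero] at this

theorem mon4_ne_zero (r a b c d : ℤ) : mon4 r a b c d ≠ 0 :=
  MonoidAlgebra.single_ne_zero.2 one_ne_zero

/-- The monomials in `q^(1/2)` and the frozen variables. -/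
noncomputable def yMonoid : Submonoid Torus where
  carrier := {t | ∃ r c d, t = mon4 r 0 0 c d}
  one_mem' := ⟨0, 0, 0, one_eq_mon4⟩
  mul_mem' := by
    rintro _ _ ⟨r, c, d, rfl⟩ ⟨r', c', d', rfl⟩
    exact ⟨_, _, _, mon4_mul _ _ _ _ _ _ _ _ _ _⟩

/-- The coefficient ring, in the quantum torus. -/
noncomputable def coeffTorus : Subring Torus := Subring.closure yMonoid

/-- The semiring of non-negative coefficients, in the quantum torus. -/
noncomputable def nonnegTorus : Subsemiring Torus := Subsemiring.closure yMonoid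

theorem coeffTorus_induction {P : Torus → Prop} (hmon : ∀ r c d, P (mon4 r 0 0 c d)) (h0 : P 0)
    (hadd : ∀ s t, P s → P t → P (s + t)) (hneg : ∀ t, P t → P (-t)) {t : Torus}
    (ht : t ∈ coeffTorus) : P t := by
  rw [coeffTorus, Subring.mem_closure_iff, Submonoid.closure_eq] at ht
  induction ht using AddSubgroup.closure_induction with
  | mem t ht => obtain ⟨r, c, d, rfl⟩ := ht; exact hmon r c d
  | zero => exact h0
  | add s t _ _ hs ht => exact hadd s t hs ht
  | neg t _ ht => exact hneg t ht

theorem nonnegTorus_induction {P : Torus → Prop} (hmon : ∀ r c d, P (mon4 r 0 0 c d)) (h0 : P 0)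
    (hadd : ∀ s t, P s → P t → P (s + t)) {t : Torus} (ht : t ∈ nonnegTorus) : P t := by
  rw [nonnegTorus, Subsemiring.mem_closure_iff, Submonoid.closure_eq] at ht
  induction ht using AddSubmonoid.closure_induction with
  | mem t ht => obtain ⟨r, c, d, rfl⟩ := ht; exact hmon r c d
  | zero => exact h0
  | add s t _ _ hs ht => exact hadd s t hs ht

theorem degPart_mul_of_mem {f : Torus} (hf : f ∈ coeffTorus) (p q : ℤ) (t : Torus) :
    degPart p q (f * t) = f * degPart p q t := by
  refine coeffTorus_induction (P := fun f => degPart p q (f * t) = f * degPart p q t)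
    (fun r c d => degPart_mon4_mul p q r c d t) (by simp) (fun s s' hs hs' => ?_)
    (fun s hs => ?_) hf
  · rw [add_mul, map_add, hs, hs', add_mul]
  · rw [neg_mul, map_neg, hs, neg_mul]

/-- Coefficients have degree zero in the first two exponents. Among the terms with nonzero
coefficient, one with minimal `a - b` has a lowest degree that no other term reaches; since the
torus is a domain, its coefficient would have to vanish. -/
theorem kroneckerBasis_linearIndependent (s : Finset ((ℤ × ℕ × ℕ) ⊕ ℕ))
    (f : (ℤ × ℕ × ℕ) ⊕ ℕ → Torus) (hf : ∀ i, f i ∈ coeffTorus)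
    (h : ∑ i ∈ s, f i * kroneckerBasis zHat xHat i = 0) : ∀ i ∈ s, f i = 0 := by
  classical
  by_contra! hne
  obtain ⟨i₁, hi₁, hf₁⟩ := hne
  obtain ⟨i, hi, hmin⟩ := (s.filter fun i => f i ≠ 0).exists_min_image
    (fun i => (gVec i).1 - (gVec i).2) ⟨i₁, Finset.mem_filter.2 ⟨hi₁, hf₁⟩⟩
  rw [Finset.mem_filter] at hi
  have h1 := congrArg (degPart (gVec i).1 (gVec i).2) h
  rw [map_sum, map_zero, Finset.sum_eq_single_of_mem i hi.1] at h1
  · obtain ⟨r, c, d, e⟩ := (pointed_kroneckerBasis i).degPart_eq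
    rw [degPart_mul_of_mem (hf i), e] at h1
    exact (mul_eq_zero.1 h1).elim hi.2 (mon4_ne_zero _ _ _ _ _)
  · intro j hj hji
    rw [degPart_mul_of_mem (hf j)]
    by_cases hfj : f j = 0
    · rw [hfj, zero_mul]
    · rw [(pointed_kroneckerBasis j).degPart_eq_zero (hmin j (Finset.mem_filter.2 ⟨hj, hfj⟩))
        (fun e => hji (gVec_injective e.symm)), mul_zero]

/-! ### Transfer from normalized elements to the actual basis -/

/-- The basis of the cluster algebra, in the quantum torus: the cluster monomials and the `S_n`. -/
noncomputable def torusBasis : (ℤ × ℕ × ℕ) ⊕ ℕ → Torus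
  | Sum.inl (m, a, b) => X m ^ (a + 1) * X (m + 1) ^ b
  | Sum.inr n => chebTorus n

/-- `s` agrees with `t` up to a monomial in `q^(1/2)` and the frozen variables. -/
def YAssociated (s t : Torus) : Prop := ∃ r c d, s = mon4 r 0 0 c d * t

theorem YAssociated.mul {s t s' t' : Torus} (h : YAssociated s t) (h' : YAssociated s' t')
    (hc : ∀ r c d, Commute (mon4 r 0 0 c d) t) : YAssociated (s * s') (t * t') := by
  obtain ⟨r, c, d, rfl⟩ := h
  obtain ⟨r', c', d', rfl⟩ := h'
  have e := mon4_mul r 0 0 c d r' 0 0 c' d'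
  rw [add_zero] at e
  have key : mon4 r 0 0 c d * t * (mon4 r' 0 0 c' d' * t') =
      mon4 r 0 0 c d * mon4 r' 0 0 c' d' * (t * t') := by
    rw [mul_assoc, ← mul_assoc t, ← (hc r' c' d').eq, mul_assoc, ← mul_assoc]
  rw [e] at key
  exact ⟨_, _, _, key⟩

theorem YAssociated.pow {s t : Torus} (h : YAssociated s t)
    (hc : ∀ r c d, Commute (mon4 r 0 0 c d) t) (n : ℕ) : YAssociated (s ^ n) (t ^ n) := by
  induction n with
  | zero => exact ⟨0, 0, 0, by rw [← one_eq_mon4]; simp⟩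
  | succ n ih =>
    rw [_root_.pow_succ, _root_.pow_succ]
    exact ih.mul h fun r c d => (hc r c d).pow_right n

/-- The factor `X^(0,0,1,1)` in the modified recurrence is what makes it homogeneous: `phi Xδ`
carries the frozen exponent `(1, 1)`, and `phi` of that factor carries `(2, 2)`. -/
theorem phi_chebTorus (n : ℕ) : phi (chebTorus n) = mon4 0 0 0 n n * chebS zHat n := by
  induction n using Nat.twoStepInduction with
  | zero => simp [chebTorus, chebS, ← one_eq_mon4]
  | one => simpa [chebTorus, chebS] using phi_Xδ
  | more n h1 h2 =>
    rw [chebTorus, map_sub, map_mul, map_mul, h1, h2, phi_Xδ, chebS, mul_sub, mul_assoc,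
      ← mul_assoc _ (mon4 0 0 0 1 1),
      ← (chebS_commute (commute_mon4_zHat 0 1 1) (n + 1)).eq, mul_assoc, ← mul_assoc,
      ← mul_assoc (phi _), show (mon 0 ![0, 0, 1, 1] : Torus) = mon4 0 0 0 1 1 from rfl, phi_mon4,
      mon4_mul, mon4_mul]
    push_cast
    congr 3 <;> ring

theorem phi_torusBasis (i : (ℤ × ℕ × ℕ) ⊕ ℕ) :
    YAssociated (phi (torusBasis i)) (kroneckerBasis zHat xHat i) := by
  have h : ∀ m, YAssociated (phi (X m)) (xHat m) := fun m => ⟨_, _, _, phi_X m⟩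
  obtain ⟨m, a, b⟩ | n := i
  · rw [torusBasis, map_mul, map_pow, map_pow]
    exact ((h m).pow (fun r c d => commute_mon4_xHat r c d m) _).mul
      ((h _).pow (fun r c d => commute_mon4_xHat r c d _) _)
      fun r c d => (commute_mon4_xHat r c d m).pow_right _
  · exact ⟨_, _, _, phi_chebTorus n⟩

theorem mon4_inv_mul (r c d : ℤ) : mon4 (-r) 0 0 (-c) (-d) * mon4 r 0 0 c d = 1 := by
  rw [mon4_mul, one_eq_mon4]; congr 1 <;> ring

theorem mon4_mul_inv (r c d : ℤ) : mon4 r 0 0 c d * mon4 (-r) 0 0 (-c) (-d) = 1 := by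
  rw [mon4_mul, one_eq_mon4]; congr 1 <;> ring

theorem commute_mon4_kroneckerBasis (r c d : ℤ) (i : (ℤ × ℕ × ℕ) ⊕ ℕ) :
    Commute (mon4 r 0 0 c d) (kroneckerBasis zHat xHat i) :=
  KroneckerRelations.commute_kroneckerBasis (commute_mon4_xHat r c d) (commute_mon4_zHat r c d) i

/-- The properties which the coefficient ring and its semiring of non-negative elements share. -/
structure IsCoeffSemiring (K : Subsemiring Torus) : Prop where
  mon4_mem : ∀ r c d, mon4 r 0 0 c d ∈ K
  commute : ∀ c ∈ K, ∀ i, Commute c (kroneckerBasis zHat xHat i)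
  phi_mem : ∀ c ∈ K, phi c ∈ K
  phiProj_mem : ∀ c ∈ K, phiProj c ∈ K

theorem isCoeffSemiring_coeffTorus : IsCoeffSemiring coeffTorus.toSubsemiring where
  mon4_mem r c d := Subring.subset_closure ⟨r, c, d, rfl⟩
  commute _ hc i := coeffTorus_induction
    (P := fun c => Commute c (kroneckerBasis zHat xHat i))
    (fun r c d => commute_mon4_kroneckerBasis r c d i) (Commute.zero_left _)
    (fun _ _ hs ht => hs.add_left ht) (fun _ hs => hs.neg_left) hc
  phi_mem _ hc := coeffTorus_induction (P := fun c => phi c ∈ coeffTorus)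
    (fun r c d => by rw [phi_mon4]; exact Subring.subset_closure ⟨_, _, _, rfl⟩)
    (by rw [map_zero]; exact zero_mem _)
    (fun _ _ hs ht => by rw [map_add]; exact add_mem hs ht)
    (fun _ hs => by rw [map_neg]; exact neg_mem hs) hc
  phiProj_mem _ hc := coeffTorus_induction (P := fun c => phiProj c ∈ coeffTorus)
    (fun r c d => by
      obtain h | ⟨r', c', d', h⟩ := phiProj_mon4_zero r c d
      · rw [h]; exact zero_mem _
      · rw [h]; exact Subring.subset_closure ⟨_, _, _, rfl⟩)
    (by rw [map_zero]; exact zero_mem _)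
    (fun _ _ hs ht => by rw [map_add]; exact add_mem hs ht)
    (fun _ hs => by rw [map_neg]; exact neg_mem hs) hc

theorem isCoeffSemiring_nonnegTorus : IsCoeffSemiring nonnegTorus where
  mon4_mem r c d := Subsemiring.subset_closure ⟨r, c, d, rfl⟩
  commute _ hc i := nonnegTorus_induction
    (P := fun c => Commute c (kroneckerBasis zHat xHat i))
    (fun r c d => commute_mon4_kroneckerBasis r c d i) (Commute.zero_left _)
    (fun _ _ hs ht => hs.add_left ht) hc
  phi_mem _ hc := nonnegTorus_induction (P := fun c => phi c ∈ nonnegTorus)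
    (fun r c d => by rw [phi_mon4]; exact Subsemiring.subset_closure ⟨_, _, _, rfl⟩)
    (by rw [map_zero]; exact zero_mem _)
    (fun _ _ hs ht => by rw [map_add]; exact add_mem hs ht) hc
  phiProj_mem _ hc := nonnegTorus_induction (P := fun c => phiProj c ∈ nonnegTorus)
    (fun r c d => by
      obtain h | ⟨r', c', d', h⟩ := phiProj_mon4_zero r c d
      · rw [h]; exact zero_mem _
      · rw [h]; exact Subsemiring.subset_closure ⟨_, _, _, rfl⟩)
    (by rw [map_zero]; exact zero_mem _)
    (fun _ _ hs ht => by rw [map_add]; exact add_mem hs ht) hc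

namespace IsCoeffSemiring

variable {K : Subsemiring Torus}

theorem wUnit_smul_one_mem (hK : IsCoeffSemiring K) (n : ℤ) : wUnit ^ n • (1 : Torus) ∈ K := by
  rw [Kronecker.wUnit_smul, mul_one]; exact hK.mon4_mem _ _ _

/-- A normalized basis element is a frozen monomial times an element of the range of `phi`, so only
the coefficient is affected by the projection. -/
theorem phiProj_mem_coeffSpan (hK : IsCoeffSemiring K) {t : Torus}
    (ht : t ∈ coeffSpan K (kroneckerBasis zHat xHat)) : phiProj t ∈ coeffSpan K torusBasis := by
  induction ht using AddSubmonoid.closure_induction with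
  | mem t ht =>
    obtain ⟨f, hf, i, rfl⟩ := ht
    obtain ⟨r, c, d, h⟩ := phi_torusBasis i
    have e : f * kroneckerBasis zHat xHat i =
        (f * mon4 (-r) 0 0 (-c) (-d)) * phi (torusBasis i) := by
      rw [h, mul_assoc, ← mul_assoc _ (mon4 r 0 0 c d), mon4_inv_mul, one_mul]
    rw [e, phiProj_mul_phi]
    exact mul_mem_coeffSpan (hK.phiProj_mem _ (mul_mem hf (hK.mon4_mem _ _ _))) i
  | zero => rw [map_zero]; exact zero_mem _
  | add s t _ _ hs ht => rw [map_add]; exact add_mem hs ht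

theorem mem_coeffSpan_iff (hK : IsCoeffSemiring K) {t : Torus} : t ∈ coeffSpan K torusBasis ↔
    phi t ∈ coeffSpan K (kroneckerBasis zHat xHat) := by
  refine ⟨fun ht => ?_, fun ht => ?_⟩
  · induction ht using AddSubmonoid.closure_induction with
    | mem t ht =>
      obtain ⟨f, hf, i, rfl⟩ := ht
      obtain ⟨r, c, d, h⟩ := phi_torusBasis i
      rw [map_mul, h, ← mul_assoc]
      exact mul_mem_coeffSpan (mul_mem (hK.phi_mem _ hf) (hK.mon4_mem _ _ _)) i
    | zero => rw [map_zero]; exact zero_mem _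
    | add s t _ _ hs ht => rw [map_add]; exact add_mem hs ht
  · have := hK.phiProj_mem_coeffSpan ht
    rwa [phiProj_phi] at this

/-- The combinations of the basis with coefficients in `K` form a semiring. -/
noncomputable def span (hK : IsCoeffSemiring K) : Subsemiring Torus :=
  (kroneckerRelations.basisSpan hK.wUnit_smul_one_mem hK.commute).comap phi

theorem mem_span (hK : IsCoeffSemiring K) {t : Torus} :
    t ∈ hK.span ↔ t ∈ coeffSpan K torusBasis := hK.mem_coeffSpan_iff.symm

theorem torusBasis_mem_span (hK : IsCoeffSemiring K) (i : (ℤ × ℕ × ℕ) ⊕ ℕ) :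
    torusBasis i ∈ hK.span := hK.mem_span.2 (mem_coeffSpan i)

/-- Up to a frozen monomial a basis element commutes with all coefficients, so passing a coefficient
through it amounts to conjugation by that monomial. This converts left statements into right ones
and preserves non-negativity. -/
theorem exists_mul_torusBasis (hK : IsCoeffSemiring K) {f : Torus} (hf : f ∈ K)
    (i : (ℤ × ℕ × ℕ) ⊕ ℕ) : ∃ g ∈ K, f * torusBasis i = torusBasis i * g := by
  obtain ⟨r, c, d, h⟩ := phi_torusBasis i
  have hg : mon4 (-r) 0 0 (-c) (-d) * phi f * mon4 r 0 0 c d ∈ K :=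
    mul_mem (mul_mem (hK.mon4_mem _ _ _) (hK.phi_mem _ hf)) (hK.mon4_mem _ _ _)
  refine ⟨_, hK.phiProj_mem _ hg, ?_⟩
  rw [← phiProj_phi_mul, h, mul_assoc, ← (hK.commute _ hg i).eq, mul_assoc, mul_assoc,
    ← mul_assoc (mon4 r 0 0 c d), mon4_mul_inv, one_mul, ← h, ← map_mul, phiProj_phi]

end IsCoeffSemiring

theorem torusBasis_linearIndependent_left (s : Finset ((ℤ × ℕ × ℕ) ⊕ ℕ))
    (f : (ℤ × ℕ × ℕ) ⊕ ℕ → Torus) (hf : ∀ i, f i ∈ coeffTorus)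
    (h : ∑ i ∈ s, f i * torusBasis i = 0) : ∀ i ∈ s, f i = 0 := by
  choose r c d hb using phi_torusBasis
  have hK := isCoeffSemiring_coeffTorus
  have h1 := congrArg phi h
  rw [map_zero, map_sum] at h1
  intro i hi
  have := kroneckerBasis_linearIndependent s (fun i => phi (f i) * mon4 (r i) 0 0 (c i) (d i))
    (fun i => mul_mem (hK.phi_mem _ (hf i)) (hK.mon4_mem _ _ _)) (by
      rw [← h1]
      refine Finset.sum_congr rfl fun i _ => ?_
      rw [map_mul, hb, mul_assoc]) i hi
  rcases mul_eq_zero.1 this with h2 | h2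
  · exact phi_injective (h2.trans (map_zero phi).symm)
  · exact absurd h2 (mon4_ne_zero _ _ _ _ _)

theorem torusBasis_linearIndependent_right (s : Finset ((ℤ × ℕ × ℕ) ⊕ ℕ))
    (f : (ℤ × ℕ × ℕ) ⊕ ℕ → Torus) (hf : ∀ i, f i ∈ coeffTorus)
    (h : ∑ i ∈ s, torusBasis i * f i = 0) : ∀ i ∈ s, f i = 0 := by
  choose r c d hb using phi_torusBasis
  have hK := isCoeffSemiring_coeffTorus
  have h1 := congrArg phi h
  rw [map_zero, map_sum] at h1
  intro i hi
  have := kroneckerBasis_linearIndependent s (fun i => mon4 (r i) 0 0 (c i) (d i) * phi (f i))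
    (fun i => mul_mem (hK.mon4_mem _ _ _) (hK.phi_mem _ (hf i))) (by
      rw [← h1]
      refine Finset.sum_congr rfl fun i _ => ?_
      rw [map_mul, hb, mul_assoc, mul_assoc, (hK.commute _ (hK.phi_mem _ (hf i)) i).eq]) i hi
  rcases mul_eq_zero.1 this with h2 | h2
  · exact absurd h2 (mon4_ne_zero _ _ _ _ _)
  · exact phi_injective (h2.trans (map_zero phi).symm)

theorem torusBasis_injective : Function.Injective torusBasis := by
  classical
  intro i j h
  by_contra hij
  have hK := isCoeffSemiring_coeffTorus
  have := torusBasis_linearIndependent_left {i, j} (fun l => if l = i then 1 else -1)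
    (fun l => by split_ifs; exacts [one_mem _, neg_mem (one_mem _)])
    (by rw [Finset.sum_pair hij]; simp [Ne.symm hij, h]) i (by simp)
  simp at this

theorem bar_chebTorus (n : ℕ) : bar (chebTorus n) = chebTorus n := by
  apply phi_injective
  rw [← bar_phi, phi_chebTorus]
  have hz : ∀ n, bar (chebS zHat n) = chebS zHat n := by
    intro n
    induction n using Nat.twoStepInduction with
    | zero => exact bar_one
    | one => exact bar_zHat
    | more n h1 h2 =>
      rw [chebS, bar_sub, h1, bar_mul_of_commute h2 bar_zHat
        (chebS_commute (Commute.refl zHat) (n + 1)).symm]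
  refine bar_mul_of_commute ?_ (hz n) (chebS_commute (commute_mon4_zHat 0 n n) n)
  rw [bar_mon4, neg_zero]

theorem bar_torusBasis (i : (ℤ × ℕ × ℕ) ⊕ ℕ) : bar (torusBasis i) = torusBasis i := by
  obtain ⟨m, a, b⟩ | n := i
  · exact bar_mul_of_commute (bar_pow (bar_X m) _) (bar_pow (bar_X _) _)
      ((commute_X_succ m).pow_pow _ _)
  · exact bar_chebTorus n

/-! ### Exchange relations and seed mutations -/

theorem incl_injective : Function.Injective incl :=
  OreLocalization.numeratorHom_inj (by
    intro x hx
    exact (mem_nonZeroDivisors_iff.1 hx).1)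

theorem X_ne_zero (m : ℤ) : X m ≠ 0 := by
  intro h
  have := torusBasis_linearIndependent_left {Sum.inl (m, 0, 0)} (fun _ => 1) (fun _ => one_mem _)
    (by simp [torusBasis, h]) (Sum.inl (m, 0, 0)) (by simp)
  exact one_ne_zero this

theorem incl_X_ne_zero (m : ℤ) : incl (X m) ≠ 0 := fun h =>
  X_ne_zero m (incl_injective (h.trans (map_zero incl).symm))

theorem incl_mon4_ne_zero (r a b c d : ℤ) : incl (mon4 r a b c d) ≠ 0 := fun h =>
  mon4_ne_zero r a b c d (incl_injective (h.trans (map_zero incl).symm))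

theorem incl_mon4_inv (r a b c d : ℤ) :
    (incl (mon4 r a b c d))⁻¹ = incl (mon4 (-r) (-a) (-b) (-c) (-d)) := by
  rw [inv_eq_iff_eq_inv, eq_comm]
  apply inv_eq_of_mul_eq_one_left
  rw [← map_mul, mon4_mul, ← map_one incl, one_eq_mon4]
  congr 2 <;> ring

theorem incl_mon4_zpow (r a b c d n : ℤ) : incl (mon4 r a b c d) ^ n =
    incl (mon4 (n * r) (n * a) (n * b) (n * c) (n * d)) := by
  induction n using Int.induction_on with
  | zero => simp [← one_eq_mon4]
  | succ n ih =>
    rw [zpow_add_one₀ (incl_mon4_ne_zero r a b c d), ih, ← map_mul, mon4_mul]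
    congr 2 <;> ring
  | pred n ih =>
    rw [zpow_sub_one₀ (incl_mon4_ne_zero r a b c d), ih, incl_mon4_inv, ← map_mul, mon4_mul]
    congr 2 <;> ring

theorem qHalf_zpow (n : ℤ) : qHalf ^ n = incl (mon4 n 0 0 0 0) := by
  rw [qHalf, mon_zero_eq, incl_mon4_zpow]
  congr 2 <;> ring

theorem yA_mul_yB_sub {i j : ℤ} (h : j = i + 1 ∨ j = i - 1) :
    yA i * yB j - yB i * yA j = j - i := by
  simp only [yA, yB]
  rcases h with rfl | rfl <;> split_ifs <;> first | omega | ring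

/-- The tropical form of the exchange relation between `X i` and `X (2 * j - i)`. With `yB_add` it
governs both the frozen coefficients of that relation and the mutation of `Λ`. -/
theorem yA_add {i j : ℤ} (h : j = i + 1 ∨ j = i - 1) :
    yA i + yA (2 * j - i) = 2 * max 0 (yA j) := by
  simp only [yA]
  rcases h with rfl | rfl <;> split_ifs <;> omega

theorem yB_add {i j : ℤ} (h : j = i + 1 ∨ j = i - 1) :
    yB i + yB (2 * j - i) = 2 * max 0 (yB j) := by
  simp only [yB]
  rcases h with rfl | rfl <;> split_ifs <;> omega

theorem xHat_mul_reflect {i j : ℤ} (h : j = i + 1 ∨ j = i - 1) :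
    xHat i * xHat (2 * j - i) = wUnit ^ (2 * (j - i)) • (xHat j * xHat j) + 1 := by
  rcases h with rfl | rfl
  · rw [show 2 * (i + 1) - i = i + 2 by ring, show 2 * (i + 1 - i) = 2 by ring, xHat_exchange]
  · have := xHat_exchange' (i - 2)
    rw [show i - 2 + 2 = i by ring, show i - 2 + 1 = i - 1 by ring] at this
    rw [show 2 * (i - 1) - i = i - 2 by ring, show 2 * (i - 1 - i) = -2 by ring, this]

theorem phi_X_mul (i j : ℤ) : phi (X i * X j) =
    mon4 (-2 * (yA i * yB j - yB i * yA j)) 0 0 (yA i + yA j) (yB i + yB j) *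
      (xHat i * xHat j) := by
  rw [map_mul, phi_X, phi_X, mul_assoc, ← mul_assoc (xHat i), ← (commute_mon4_xHat _ _ _ i).eq,
    mul_assoc, ← mul_assoc (mon4 0 0 0 _ _), mon4_mul]
  congr 2; ring

/-- The coefficient-free exchange relation multiplied by the frozen prefactors. By `yA_add` and
`yB_add` the constant term receives the positive parts of `yA j`, `yB j`; the prefactors of `X j * X
j` account for the rest up to the negative parts. -/
theorem X_mul_reflect {i j : ℤ} (h : j = i + 1 ∨ j = i - 1) :
    X i * X (2 * j - i) =
      mon4 (max 0 (yA j) * yB i - max 0 (yB j) * yA i) 0 0 (max 0 (yA j)) (max 0 (yB j)) +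
      mon4 (max 0 (-yA j) * (yB i - 2 * yB j) - max 0 (-yB j) * (yA i - 2 * yA j)) 0 0 0 0 *
        (X j * X j) * mon4 0 0 0 (max 0 (-yA j)) (max 0 (-yB j)) := by
  apply phi_injective
  have hA := yA_add h
  have hB := yB_add h
  have hs := yA_mul_yB_sub h
  have eA : max 0 (-yA j) = max 0 (yA j) - yA j := by omega
  have eB : max 0 (-yB j) = max 0 (yB j) - yB j := by omega
  rw [map_add, phi_X_mul, map_mul, map_mul, phi_X_mul, xHat_mul_reflect h, phi_mon4, phi_mon4,
    phi_mon4, eA, eB, hA, hB, mul_add, mul_one, add_comm]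
  generalize max 0 (yA j) = p at *
  generalize max 0 (yB j) = q at *
  rw [show yA (2 * j - i) = 2 * p - yA i by linarith, show yB (2 * j - i) = 2 * q - yB i by linarith]
  congr 1
  · congr 1; ring
  · simp only [mul_zero]
    rw [mul_assoc, mul_assoc (mon4 _ 0 0 _ _),
      ← ((commute_mon4_xHat _ _ _ j).mul_right (commute_mon4_xHat _ _ _ j)).eq, ← mul_assoc,
      ← mul_assoc, mon4_mul, mon4_mul, mul_smul_comm, ← smul_mul_assoc, wUnit_smul_mon4]
    congr 2
    · rw [← hs]; ring
    all_goals ring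

theorem incl_frozen_mul (p q : ℤ) :
    incl (mon4 0 0 0 1 0) ^ p * incl (mon4 0 0 0 0 1) ^ q = incl (mon4 (-2 * p * q) 0 0 p q) := by
  rw [incl_mon4_zpow, incl_mon4_zpow, ← map_mul, mon4_mul]
  congr 2 <;> ring

theorem commute_qHalf_zpow_incl (n : ℤ) (t : Torus) : Commute (qHalf ^ n) (incl t) := by
  rw [qHalf_zpow]; exact (commute_mon4_zero n t).map incl

/-- The exchange relation in the skew-field of fractions. -/
theorem incl_X_reflect {i j : ℤ} (h : j = i + 1 ∨ j = i - 1) :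
    incl (X (2 * j - i)) =
      qHalf ^ (max 0 (yA j) * yB i - max 0 (yB j) * yA i + 2 * max 0 (yA j) * max 0 (yB j)) *
        ((incl (X i))⁻¹ * (incl (mon4 0 0 0 1 0) ^ max 0 (yA j) *
          incl (mon4 0 0 0 0 1) ^ max 0 (yB j))) +
      qHalf ^ (max 0 (-yA j) * (yB i - 2 * yB j) - max 0 (-yB j) * (yA i - 2 * yA j) +
          2 * max 0 (-yA j) * max 0 (-yB j)) *
        ((incl (X i))⁻¹ * (incl (X j) ^ (2 : ℤ) * (incl (mon4 0 0 0 1 0) ^ max 0 (-yA j) *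
          incl (mon4 0 0 0 0 1) ^ max 0 (-yB j)))) := by
  have h0 := incl_X_ne_zero i
  have hc : ∀ n : ℤ, Commute (qHalf ^ n) (incl (X i))⁻¹ := fun n =>
    (commute_qHalf_zpow_incl n (X i)).inv_right₀
  have hc' : ∀ (n : ℤ) (t : Frac), qHalf ^ n * ((incl (X i))⁻¹ * t) =
      (incl (X i))⁻¹ * (qHalf ^ n * t) := fun n t => by
    rw [← mul_assoc, (hc n).eq, mul_assoc]
  rw [hc', hc', ← mul_add, eq_inv_mul_iff_mul_eq₀ h0, ← map_mul, X_mul_reflect h, map_add,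
    incl_frozen_mul, incl_frozen_mul, qHalf_zpow, qHalf_zpow, zpow_two, ← map_mul, ← map_mul,
    ← map_mul, ← map_mul]
  congr 2
  · rw [mon4_mul]; congr 1 <;> ring
  · rw [mul_assoc, (commute_mon4_zero _ _).eq, (commute_mon4_zero _ _).eq, mul_assoc, mul_assoc,
      mon4_mul, mul_assoc, mul_assoc, mon4_mul]
    congr 2; ring_nf

theorem monomial_eq {F : Type*} [DivisionRing F] (v : F) (S : QuantumSeed F 2 2)
    (e : Fin (2 + 2) → ℤ) : S.monomial v e =
      v ^ (-(S.Lam 0 1 * e 0 * e 1 + S.Lam 0 2 * e 0 * e 2 + S.Lam 0 3 * e 0 * e 3 +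
        S.Lam 1 2 * e 1 * e 2 + S.Lam 1 3 * e 1 * e 3 + S.Lam 2 3 * e 2 * e 3)) *
      (S.X 0 ^ e 0 * (S.X 1 ^ e 1 * (S.X 2 ^ e 2 * S.X 3 ^ e 3))) := by
  have h0 : Finset.Ioi (0 : Fin (2 + 2)) = {1, 2, 3} := by decide
  have h1 : Finset.Ioi (1 : Fin (2 + 2)) = {2, 3} := by decide
  have h2 : Finset.Ioi (2 : Fin (2 + 2)) = {3} := by decide
  have h3 : Finset.Ioi (3 : Fin (2 + 2)) = ∅ := by decide
  have hs : ∀ f : Fin (2 + 2) → ℤ, ∑ i, f i = f 0 + f 1 + f 2 + f 3 := fun f =>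
    Fin.sum_univ_four f
  rw [QuantumSeed.monomial, hs, h0, h1, h2, h3]
  congr 1
  · congr 2
    simp
    ring
  · simp [List.ofFn_succ]

/-- The seed with cluster variables `X i` and `X j`, where `i` and `j` are neighbours. -/
noncomputable def clusterSeed (i j : ℤ) : QuantumSeed Frac 2 2 where
  -- The upper left block vanishes since neighbours commute. In `B` the sign `j - i = ±1` records
  -- the orientation.
  Lam := !![0, 0, yB i, -yA i; 0, 0, yB j, -yA j; -yB i, -yB j, 0, -2; yA i, yA j, 2, 0]
  B := !![0, 2 * (j - i); -(2 * (j - i)), 0; (j - i) * yA j, -((j - i) * yA i);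
    (j - i) * yB j, -((j - i) * yB i)]
  X := ![incl (X i), incl (X j), incl (mon4 0 0 0 1 0), incl (mon4 0 0 0 0 1)]

theorem clusterSeed_one_two : clusterSeed 1 2 = seed := by
  have h : ∀ i, (mon 0 (Pi.single i 1) : Torus) = mon4 0 ((Pi.single i 1 : Fin (2 + 2) → ℤ) 0)
    ((Pi.single i 1 : Fin (2 + 2) → ℤ) 1) ((Pi.single i 1 : Fin (2 + 2) → ℤ) 2)
    ((Pi.single i 1 : Fin (2 + 2) → ℤ) 3) := fun i => mon_eq_mon4 _ _
  refine QuantumSeed.ext ?_ ?_ ?_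
  · ext i j; fin_cases i <;> fin_cases j <;> rfl
  · ext i j; fin_cases i <;> fin_cases j <;> rfl
  · funext i
    simp only [seed, clusterSeed, h, X_one, X_two]
    fin_cases i <;> rfl

theorem mutationMatrix_zero (B : Matrix (Fin (2 + 2)) (Fin 2) ℤ) :
    QuantumSeed.mutationMatrix B 0 = !![-1, 0, 0, 0; max 0 (-B 1 0), 1, 0, 0;
      max 0 (-B 2 0), 0, 1, 0; max 0 (-B 3 0), 0, 0, 1] := by
  ext k l; fin_cases k <;> fin_cases l <;> rfl

theorem mutationMatrix_one (B : Matrix (Fin (2 + 2)) (Fin 2) ℤ) :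
    QuantumSeed.mutationMatrix B 1 = !![1, max 0 (-B 0 1), 0, 0; 0, -1, 0, 0;
      0, max 0 (-B 2 1), 1, 0; 0, max 0 (-B 3 1), 0, 1] := by
  ext k l; fin_cases k <;> fin_cases l <;> rfl

theorem transform_zero (t p q a b a' b' : ℤ) :
    (!![-1, 0, 0, 0; t, 1, 0, 0; p, 0, 1, 0; q, 0, 0, 1] : Matrix (Fin 4) (Fin 4) ℤ)ᵀ *
      !![0, 0, b, -a; 0, 0, b', -a'; -b, -b', 0, -2; a, a', 2, 0] *
      !![-1, 0, 0, 0; t, 1, 0, 0; p, 0, 1, 0; q, 0, 0, 1] =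
    !![0, q * a' - p * b', -b + t * b' + 2 * q, -(-a + t * a' + 2 * p);
      -(q * a' - p * b'), 0, b', -a';
      -(-b + t * b' + 2 * q), -b', 0, -2;
      -a + t * a' + 2 * p, a', 2, 0] := by
  ext k l
  fin_cases k <;> fin_cases l <;> simp [Matrix.mul_apply, Fin.sum_univ_succ] <;> ring

theorem transform_one (t p q a b a' b' : ℤ) :
    (!![1, t, 0, 0; 0, -1, 0, 0; 0, p, 1, 0; 0, q, 0, 1] : Matrix (Fin 4) (Fin 4) ℤ)ᵀ *
      !![0, 0, b, -a; 0, 0, b', -a'; -b, -b', 0, -2; a, a', 2, 0] *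
      !![1, t, 0, 0; 0, -1, 0, 0; 0, p, 1, 0; 0, q, 0, 1] =
    !![0, -(q * a - p * b), b, -a;
      q * a - p * b, 0, -b' + t * b + 2 * q, -(-a' + t * a + 2 * p);
      -b, -(-b' + t * b + 2 * q), 0, -2;
      a, -a' + t * a + 2 * p, 2, 0] := by
  ext k l
  fin_cases k <;> fin_cases l <;> simp [Matrix.mul_apply, Fin.sum_univ_succ] <;> ring

/-- Sign-coherence: `yA j` and `yB j` never have opposite signs. It keeps the mutable block of `Λ`
equal to zero under mutation. -/
theorem max_mul_eq (j : ℤ) : max 0 (yA j) * yB j = max 0 (yB j) * yA j := by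
  simp only [yA, yB]
  split_ifs
  · rcases eq_or_lt_of_le (show 1 ≤ j by omega) with rfl | h
    · norm_num
    · rw [max_eq_right (by omega), max_eq_right (by omega)]; ring
  · rcases eq_or_lt_of_le (show j ≤ 0 by omega) with rfl | h
    · norm_num
    · rw [max_eq_right (by omega), max_eq_right (by omega)]; ring

theorem sub_mul_max_eq_zero {s a b : ℤ} (hs : s = 1 ∨ s = -1)
    (hm : max 0 a * b = max 0 b * a) : max 0 (-(s * b)) * a - max 0 (-(s * a)) * b = 0 := by
  rcases hs with rfl | rfl
  · have eA : max 0 (-(1 * a)) = max 0 a - a := by omega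
    have eB : max 0 (-(1 * b)) = max 0 b - b := by omega
    rw [eA, eB]
    linarith
  · simp only [neg_mul, one_mul, neg_neg]
    linarith

theorem tropical_eq {s b b' b'' : ℤ} (hs : s = 1 ∨ s = -1) (h : b + b'' = 2 * max 0 b') :
    -b + max 0 (2 * s) * b' + 2 * max 0 (-(s * b')) = b'' := by
  rcases hs with rfl | rfl
  · norm_num; omega
  · norm_num; omega

theorem commute_incl_X {i j : ℤ} (h : j = i + 1 ∨ j = i - 1) : Commute (incl (X i)) (incl (X j)) := by
  rcases h with rfl | rfl
  · exact (commute_X_succ i).map incl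
  · have := (commute_X_succ (i - 1)).symm.map incl
    rwa [sub_add_cancel] at this

/-- The new variable is the other neighbour of `X j`. The matrix part reduces to sign-coherence and
the tropical relations, the variable part to `incl_X_reflect`. -/
theorem clusterSeed_mutate_zero {i j : ℤ} (h : j = i + 1 ∨ j = i - 1) :
    (clusterSeed i j).mutate qHalf 0 = clusterSeed (2 * j - i) j := by
  have hA := yA_add h
  have hB := yB_add h
  have hs : j - i = 1 ∨ j - i = -1 := by omega
  refine QuantumSeed.ext ?_ ?_ ?_
  · have h1 : (clusterSeed i j).B 1 0 = -(2 * (j - i)) := rfl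
    have h2 : (clusterSeed i j).B 2 0 = (j - i) * yA j := rfl
    have h3 : (clusterSeed i j).B 3 0 = (j - i) * yB j := rfl
    refine (congrArg (fun E => Eᵀ * (clusterSeed i j).Lam * E)
      (mutationMatrix_zero (clusterSeed i j).B)).trans ((transform_zero _ _ _ _ _ _ _).trans ?_)
    rw [h1, h2, h3, neg_neg, sub_mul_max_eq_zero hs (max_mul_eq j), tropical_eq hs hA,
      tropical_eq hs hB, neg_zero]
    rfl
  · have e : j - (2 * j - i) = i - j := by ring
    have hs' : j - i = 1 ∧ i - j = -1 ∨ j - i = -1 ∧ i - j = 1 := by omega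
    ext a b
    fin_cases a <;> fin_cases b <;> simp [QuantumSeed.mutate, clusterSeed, e] <;>
      rcases hs' with hs' | hs' <;> norm_num [hs'] <;> omega
  · funext a
    simp only [QuantumSeed.mutate, monomial_eq]
    fin_cases a
    · simp [clusterSeed, Fin.ext_iff]
      rw [incl_X_reflect h]
      rcases hs with hs | hs
      · simp [hs]
        congr 3 <;> ring
      · simp [hs]
        -- For orientation `-1` the positive and negative parts of the column of `B` exchange roles,
        -- and with them the two summands.
        rw [add_comm]
        congr 3 <;> ring
    all_goals simp [clusterSeed, Fin.ext_iff]

theorem clusterSeed_mutate_one {i j : ℤ} (h : i = j + 1 ∨ i = j - 1) :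
    (clusterSeed i j).mutate qHalf 1 = clusterSeed i (2 * i - j) := by
  have hA := yA_add h
  have hB := yB_add h
  have hs : i - j = 1 ∨ i - j = -1 := by omega
  refine QuantumSeed.ext ?_ ?_ ?_
  · have h1 : -(clusterSeed i j).B 0 1 = 2 * (i - j) := by simp [clusterSeed]; ring
    have h2 : (clusterSeed i j).B 2 1 = (i - j) * yA i := by simp [clusterSeed]; ring
    have h3 : (clusterSeed i j).B 3 1 = (i - j) * yB i := by simp [clusterSeed]; ring
    refine (congrArg (fun E => Eᵀ * (clusterSeed i j).Lam * E)
      (mutationMatrix_one (clusterSeed i j).B)).trans ((transform_one _ _ _ _ _ _ _).trans ?_)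
    rw [h1, h2, h3, sub_mul_max_eq_zero hs (max_mul_eq i), tropical_eq hs hA,
      tropical_eq hs hB, neg_zero]
    rfl
  · have e : 2 * i - j - i = i - j := by ring
    have hs' : j - i = 1 ∧ i - j = -1 ∨ j - i = -1 ∧ i - j = 1 := by omega
    ext a b
    fin_cases a <;> fin_cases b <;> simp [QuantumSeed.mutate, clusterSeed, e] <;>
      rcases hs' with hs' | hs' <;> norm_num [hs'] <;> omega
  -- In direction `1` the normalized monomial lists `X i` before the inverted variable, opposite to
  -- the order in `incl_X_reflect`.
  · have hc : ∀ t, incl (X i) ^ 2 * ((incl (X j))⁻¹ * t) = (incl (X j))⁻¹ * (incl (X i) ^ 2 * t) :=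
      fun t => by
        rw [← mul_assoc, ← ((commute_incl_X h).inv_left₀.pow_right 2).eq, mul_assoc]
    funext a
    simp only [QuantumSeed.mutate, monomial_eq]
    fin_cases a
    · simp [clusterSeed, Fin.ext_iff]
    · simp [clusterSeed, Fin.ext_iff]
      rw [incl_X_reflect h]
      have hs' : j - i = -1 ∨ j - i = 1 := by omega
      rcases hs' with hs | hs
      · simp [hs]
        rw [hc]
        congr 3 <;> ring
      · simp [hs]
        rw [hc, add_comm]
        congr 3 <;> ring
    all_goals simp [clusterSeed, Fin.ext_iff]

theorem eq_clusterSeed_of_mutationEquivalent {S : QuantumSeed Frac 2 2}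
    (h : MutationEquivalent qHalf seed S) :
    ∃ i j : ℤ, (j = i + 1 ∨ j = i - 1) ∧ S = clusterSeed i j := by
  induction h with
  | refl => exact ⟨1, 2, Or.inl rfl, clusterSeed_one_two.symm⟩
  | tail _ h ih =>
    obtain ⟨i, j, hij, rfl⟩ := ih
    obtain ⟨k, rfl⟩ := h
    fin_cases k
    · exact ⟨_, _, by omega, clusterSeed_mutate_zero hij⟩
    · exact ⟨_, _, by omega, clusterSeed_mutate_one (by omega)⟩

theorem mutationEquivalent_mutate_zero {i j i' : ℤ} (h : j = i + 1 ∨ j = i - 1)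
    (hi : i' = 2 * j - i) (hS : MutationEquivalent qHalf seed (clusterSeed i j)) :
    MutationEquivalent qHalf seed (clusterSeed i' j) :=
  hS.tail ⟨0, by rw [clusterSeed_mutate_zero h, hi]⟩

theorem mutationEquivalent_mutate_one {i j j' : ℤ} (h : i = j + 1 ∨ i = j - 1)
    (hj : j' = 2 * i - j) (hS : MutationEquivalent qHalf seed (clusterSeed i j)) :
    MutationEquivalent qHalf seed (clusterSeed i j') :=
  hS.tail ⟨1, by rw [clusterSeed_mutate_one h, hj]⟩

theorem mutationEquivalent_clusterSeed_odd (n : ℤ) :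
    MutationEquivalent qHalf seed (clusterSeed (2 * n + 1) (2 * n + 2)) := by
  induction n using Int.induction_on with
  | zero =>
    have := clusterSeed_one_two
    norm_num [this]
    exact Relation.ReflTransGen.refl
  | succ n ih =>
    exact mutationEquivalent_mutate_one (by omega) (by ring)
      (mutationEquivalent_mutate_zero (i' := 2 * (n + 1) + 1) (by omega) (by ring) ih)
  | pred n ih =>
    exact mutationEquivalent_mutate_zero (by omega) (by ring)
      (mutationEquivalent_mutate_one (j' := 2 * (-n - 1) + 2) (by omega) (by ring) ih)

/-- Every pair of neighbouring cluster variables occurs in a seed. -/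
theorem exists_mutationEquivalent (m : ℤ) :
    MutationEquivalent qHalf seed (clusterSeed m (m + 1)) ∨
      MutationEquivalent qHalf seed (clusterSeed (m + 1) m) := by
  -- Reflections preserve parity, so odd indices always occupy the first slot; for even `m` the seed
  -- is the one with the pair reversed.
  obtain ⟨n, rfl | rfl⟩ : ∃ n, m = 2 * n + 1 ∨ m = 2 * n + 2 := ⟨(m - 1) / 2, by omega⟩
  · rw [show 2 * n + 1 + 1 = 2 * n + 2 by ring]
    exact Or.inl (mutationEquivalent_clusterSeed_odd n)
  · exact Or.inr (mutationEquivalent_mutate_zero (by omega) (by ring)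
      (mutationEquivalent_clusterSeed_odd n))

theorem clusterVariables_seed : seed.clusterVariables qHalf = Set.range fun m => incl (X m) := by
  ext x
  constructor
  · rintro ⟨S, hS, k, rfl⟩
    obtain ⟨i, j, -, rfl⟩ := eq_clusterSeed_of_mutationEquivalent hS
    fin_cases k
    exacts [⟨i, rfl⟩, ⟨j, rfl⟩]
  · rintro ⟨m, rfl⟩
    rcases exists_mutationEquivalent m with h | h
    exacts [⟨_, h, 0, rfl⟩, ⟨_, h, 1, rfl⟩]

/-! ### Identification of cluster monomials and of the set `basisS` -/

theorem clusterSeed_monomial (i j : ℤ) (a b : ℕ) :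
    (clusterSeed i j).monomial qHalf ![a, b, 0, 0] = incl (X i ^ a * X j ^ b) := by
  rw [monomial_eq]
  simp [clusterSeed]

theorem mem_clusterMonomials_iff {x : Frac} : x ∈ clusterMonomials ↔
    ∃ (m : ℤ) (a b : ℕ), x = incl (X m ^ a * X (m + 1) ^ b) := by
  constructor
  · rintro ⟨S, hS, e, he, hf, rfl⟩
    obtain ⟨i, j, hij, rfl⟩ := eq_clusterSeed_of_mutationEquivalent hS
    obtain ⟨a, ha⟩ := Int.eq_ofNat_of_zero_le (he 0)
    obtain ⟨b, hb⟩ := Int.eq_ofNat_of_zero_le (he 1)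
    have : e = ![(a : ℤ), b, 0, 0] := by
      funext l
      fin_cases l
      exacts [ha, hb, hf 0, hf 1]
    rw [this, clusterSeed_monomial]
    rcases hij with rfl | rfl
    · exact ⟨i, a, b, rfl⟩
    · refine ⟨i - 1, b, a, ?_⟩
      have := commute_X_succ (i - 1)
      rw [sub_add_cancel] at this ⊢
      rw [(this.pow_pow b a).eq]
  · rintro ⟨m, a, b, rfl⟩
    have nonneg : ∀ (a b : ℕ) (i), 0 ≤ (![(a : ℤ), b, 0, 0] : Fin (2 + 2) → ℤ) i := by
      intro a b i
      fin_cases i <;> simp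
    have frozen : ∀ (a b : ℕ) (j : Fin 2),
        (![(a : ℤ), b, 0, 0] : Fin (2 + 2) → ℤ) (Fin.natAdd 2 j) = 0 := by
      intro a b j
      fin_cases j <;> rfl
    rcases exists_mutationEquivalent m with h | h
    · exact ⟨_, h, ![a, b, 0, 0], nonneg a b, frozen a b, (clusterSeed_monomial _ _ _ _).symm⟩
    · refine ⟨_, h, ![b, a, 0, 0], nonneg b a, frozen b a, ?_⟩
      rw [clusterSeed_monomial, ((commute_X_succ m).pow_pow a b).eq]

/-- Unique indexing: the monomial `1` is counted as `S_0`, and a pure power belongs to the cluster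
in which its variable has the smaller index. This is the purpose of the exponent `a + 1`. -/
theorem clusterMonomials_eq : clusterMonomials =
    (fun i => incl (torusBasis i)) '' {i | ∀ n, 1 ≤ n → i ≠ Sum.inr n} := by
  ext x
  rw [mem_clusterMonomials_iff]
  constructor
  · rintro ⟨m, a, b, rfl⟩
    rcases a with _ | a
    · rcases b with _ | b
      · refine ⟨Sum.inr 0, fun n hn h => ?_, by simp [torusBasis, chebTorus]⟩
        have := Sum.inr_injective h
        omega
      · exact ⟨Sum.inl (m + 1, b, 0), by simp, by simp [torusBasis]⟩
    · exact ⟨Sum.inl (m, a, b), by simp, rfl⟩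
  · rintro ⟨⟨m, a, b⟩ | n, hi, rfl⟩
    · exact ⟨m, a + 1, b, rfl⟩
    · have : n = 0 := by
        by_contra h
        exact hi n (by omega) rfl
      exact ⟨0, 0, 0, by simp [this, torusBasis, chebTorus]⟩

theorem incl_torusBasis_injective : Function.Injective fun i => incl (torusBasis i) :=
  incl_injective.comp torusBasis_injective

theorem basisS_eq : basisS = Set.range fun i => incl (torusBasis i) := by
  rw [basisS, clusterMonomials_eq]
  ext x
  constructor
  · rintro (⟨i, -, rfl⟩ | ⟨n, -, rfl⟩)
    exacts [⟨i, rfl⟩, ⟨Sum.inr n, rfl⟩]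
  · rintro ⟨i, rfl⟩
    by_cases h : ∃ n, 1 ≤ n ∧ i = Sum.inr n
    · obtain ⟨n, hn, rfl⟩ := h
      exact Or.inr ⟨n, hn, rfl⟩
    · push Not at h
      exact Or.inl ⟨i, h, rfl⟩

theorem disjoint_clusterMonomials_cheb :
    Disjoint clusterMonomials {x | ∃ n, 1 ≤ n ∧ x = cheb n} := by
  rw [clusterMonomials_eq, Set.disjoint_left]
  rintro _ ⟨i, hi, rfl⟩ ⟨n, hn, h⟩
  exact hi n hn (incl_torusBasis_injective h)

theorem cheb_injective : Function.Injective cheb :=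
  incl_torusBasis_injective.comp Sum.inr_injective

theorem isBarInvariant_of_mem_basisS {x : Frac} (hx : x ∈ basisS) : IsBarInvariant x := by
  rw [basisS_eq] at hx
  obtain ⟨i, rfl⟩ := hx
  exact ⟨_, rfl, bar_torusBasis i⟩

theorem X_zero : X 0 = mon4 0 2 (-1) 0 1 + mon4 0 0 (-1) 0 0 := by rw [X, phiX_zero, phiProj_phi]

theorem X_three : X 3 = mon4 0 (-1) 2 0 0 + mon4 0 (-1) 0 1 0 := by
  apply phi_injective
  rw [phi_X, xHat_three, map_add, phi_mon4, phi_mon4, mul_add, mon4_mul, mon4_mul]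
  simp only [yA, yB]
  norm_num

/-- The product formula for gap three, with frozen coefficients, solved for its tail. It puts all
`S_n` into the cluster algebra. -/
theorem Xδ_eq : Xδ = X 0 * X 3 - mon4 1 0 0 0 1 * (X 1 * X 2) := by
  have h : Xδ = mon4 0 1 (-1) 1 1 + mon4 0 (-1) (-1) 1 0 + mon4 0 (-1) 1 0 0 := rfl
  rw [X_zero, X_three, X_one, X_two, add_mul, mul_add, mul_add, mon4_mul, mon4_mul, mon4_mul,
    mon4_mul, mon4_mul, mon4_mul, h]
  norm_num
  abel

/-! ### Coefficient ring and cluster algebra as images from the torus -/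

theorem zpow_mem_closure {F : Type*} [DivisionRing F] {s : Set F} {x : F} (h : x ∈ s)
    (h' : x⁻¹ ∈ s) (n : ℤ) : x ^ n ∈ Submonoid.closure s := by
  obtain ⟨k, rfl | rfl⟩ := n.eq_nat_or_neg
  · rw [zpow_natCast]
    exact pow_mem (Submonoid.subset_closure h) k
  · rw [_root_.zpow_neg, ← _root_.inv_zpow, zpow_natCast]
    exact pow_mem (Submonoid.subset_closure h') k

/-- The monomials in `q^(1/2)` and the frozen variables form the monoid generated by the
generators of the coefficient ring. -/
theorem map_yMonoid : yMonoid.map incl = Submonoid.closure (seed.coeffGenerators qHalf) := by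
  have hq : qHalf = incl (mon4 1 0 0 0 0) := by rw [qHalf, mon_zero_eq]
  have hX : ∀ j : Fin 2, seed.X (Fin.natAdd 2 j) =
      incl (mon4 0 0 0 (if j = 0 then 1 else 0) (if j = 1 then 1 else 0)) := by
    intro j
    rw [← clusterSeed_one_two]
    fin_cases j <;> rfl
  apply le_antisymm
  · rintro _ ⟨_, ⟨r, c, d, rfl⟩, rfl⟩
    have e : incl (mon4 r 0 0 c d) =
        qHalf ^ (r + 2 * c * d) * (incl (mon4 0 0 0 1 0) ^ c * incl (mon4 0 0 0 0 1) ^ d) := by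
      rw [incl_frozen_mul, qHalf_zpow, ← map_mul, mon4_mul]
      congr 2 <;> ring
    have hs : ∀ j, seed.X (Fin.natAdd 2 j) ∈ seed.coeffGenerators qHalf := fun j =>
      Or.inl (Or.inr ⟨j, rfl⟩)
    have hs' : ∀ j, (seed.X (Fin.natAdd 2 j))⁻¹ ∈ seed.coeffGenerators qHalf := fun j =>
      Or.inr ⟨j, rfl⟩
    have hv : qHalf ∈ seed.coeffGenerators qHalf := Or.inl (Or.inl (Or.inl rfl))
    have hv' : qHalf⁻¹ ∈ seed.coeffGenerators qHalf := Or.inl (Or.inl (Or.inr rfl))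
    have h0 : seed.X (Fin.natAdd 2 0) = incl (mon4 0 0 0 1 0) := hX 0
    have h1 : seed.X (Fin.natAdd 2 1) = incl (mon4 0 0 0 0 1) := hX 1
    rw [e, ← h0, ← h1]
    exact mul_mem (zpow_mem_closure hv hv' _)
      (mul_mem (zpow_mem_closure (hs 0) (hs' 0) _) (zpow_mem_closure (hs 1) (hs' 1) _))
  · rw [Submonoid.closure_le]
    rintro _ (((rfl | rfl) | ⟨j, rfl⟩) | ⟨j, rfl⟩)
    · exact ⟨_, ⟨1, 0, 0, rfl⟩, hq.symm⟩
    · exact ⟨_, ⟨-1, 0, 0, rfl⟩, by rw [hq, incl_mon4_inv]; rfl⟩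
    · exact ⟨_, ⟨_, _, _, rfl⟩, (hX j).symm⟩
    · have e := congrArg (·⁻¹) (hX j)
      simp only [incl_mon4_inv] at e
      exact ⟨_, ⟨_, _, _, rfl⟩, e.symm⟩

theorem coeffRing_eq : coeffRing = coeffTorus.map incl := by
  have h : incl '' (yMonoid : Set Torus) = Submonoid.closure (seed.coeffGenerators qHalf) := by
    rw [← map_yMonoid]; rfl
  rw [coeffRing, QuantumSeed.coeffRing, coeffTorus, RingHom.map_closure, h]
  refine le_antisymm (Subring.closure_mono Submonoid.subset_closure) (Subring.closure_le.2 ?_)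
  exact (Submonoid.closure_le (S := (Subring.closure _).toSubmonoid)).2 Subring.subset_closure

theorem mem_coeffRing {x : Frac} : x ∈ coeffRing ↔ ∃ c ∈ coeffTorus, incl c = x := by
  rw [coeffRing_eq]; rfl

theorem nonnegCoeffs_eq : nonnegCoeffs = nonnegTorus.map incl := by
  have h : incl '' (yMonoid : Set Torus) = Submonoid.closure (seed.coeffGenerators qHalf) := by
    rw [← map_yMonoid]; rfl
  rw [nonnegCoeffs, QuantumSeed.nonnegCoeffs, nonnegTorus, RingHom.map_closureS, h,
    Subsemiring.closure_submonoid_closure]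

theorem mem_span_of_mem_coeffTorus {c : Torus} (hc : c ∈ coeffTorus) :
    c ∈ isCoeffSemiring_coeffTorus.span := by
  have : c * torusBasis (Sum.inr 0) ∈ coeffSpan coeffTorus.toSubsemiring torusBasis :=
    mul_mem_coeffSpan hc _
  rw [isCoeffSemiring_coeffTorus.mem_span]
  simpa [torusBasis, chebTorus] using this

/-- The cluster algebra, in the quantum torus. -/
noncomputable def clusterTorus : Subring Torus where
  __ := isCoeffSemiring_coeffTorus.span
  neg_mem' {t} ht := by
    have := mul_mem (mem_span_of_mem_coeffTorus (neg_mem (one_mem coeffTorus))) ht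
    rwa [neg_one_mul] at this

theorem mem_clusterTorus {t : Torus} :
    t ∈ clusterTorus ↔ t ∈ coeffSpan coeffTorus.toSubsemiring torusBasis :=
  isCoeffSemiring_coeffTorus.mem_span

theorem incl_mem_clusterAlgebra_of_mem_coeffTorus {c : Torus} (hc : c ∈ coeffTorus) :
    incl c ∈ clusterAlgebra := by
  refine Subring.subset_closure (Or.inl ?_)
  exact mem_coeffRing.2 ⟨c, hc, rfl⟩

theorem incl_X_mem_clusterAlgebra (m : ℤ) : incl (X m) ∈ clusterAlgebra :=
  Subring.subset_closure (Or.inr (by rw [clusterVariables_seed]; exact ⟨m, rfl⟩))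

theorem incl_chebTorus_mem_clusterAlgebra (n : ℕ) : incl (chebTorus n) ∈ clusterAlgebra := by
  have hmon : ∀ r c d, incl (mon4 r 0 0 c d) ∈ clusterAlgebra := fun r c d =>
    incl_mem_clusterAlgebra_of_mem_coeffTorus (Subring.subset_closure ⟨r, c, d, rfl⟩)
  have hδ : incl Xδ ∈ clusterAlgebra := by
    rw [Xδ_eq, map_sub, map_mul, map_mul, map_mul]
    have := incl_X_mem_clusterAlgebra
    exact sub_mem (mul_mem (this 0) (this 3)) (mul_mem (hmon _ _ _) (mul_mem (this 1) (this 2)))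
  induction n using Nat.twoStepInduction with
  | zero => rw [chebTorus, map_one]; exact one_mem _
  | one => exact hδ
  | more n h1 h2 =>
    rw [chebTorus, map_sub, map_mul, map_mul]
    exact sub_mem (mul_mem h2 hδ) (mul_mem (hmon 0 1 1) h1)

theorem incl_torusBasis_mem_clusterAlgebra (i : (ℤ × ℕ × ℕ) ⊕ ℕ) :
    incl (torusBasis i) ∈ clusterAlgebra := by
  obtain ⟨m, a, b⟩ | n := i
  · rw [torusBasis, map_mul, map_pow, map_pow]
    exact mul_mem (pow_mem (incl_X_mem_clusterAlgebra _) _)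
      (pow_mem (incl_X_mem_clusterAlgebra _) _)
  · exact incl_chebTorus_mem_clusterAlgebra n

/-- The span of the basis is already a ring, by straightening, and contains all generators;
conversely each basis element is a polynomial in generators. -/
theorem clusterAlgebra_eq : clusterAlgebra = clusterTorus.map incl := by
  apply le_antisymm
  · refine Subring.closure_le.2 (Set.union_subset ?_ ?_)
    · change (coeffRing : Set Frac) ⊆ _
      rw [coeffRing_eq]
      rintro _ ⟨c, hc, rfl⟩
      exact ⟨c, mem_span_of_mem_coeffTorus hc, rfl⟩
    · rw [clusterVariables_seed]
      rintro _ ⟨m, rfl⟩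
      refine ⟨X m, ?_, rfl⟩
      have := isCoeffSemiring_coeffTorus.torusBasis_mem_span (Sum.inl (m, 0, 0))
      rw [torusBasis, zero_add, _root_.pow_one, _root_.pow_zero, mul_one] at this
      exact this
  · rintro _ ⟨t, ht, rfl⟩
    exact coeffSpan_le (P := (clusterAlgebra.comap incl).toAddSubmonoid) (fun c hc i => by
      change incl (c * torusBasis i) ∈ clusterAlgebra
      rw [map_mul]
      exact mul_mem (incl_mem_clusterAlgebra_of_mem_coeffTorus hc)
        (incl_torusBasis_mem_clusterAlgebra i)) (mem_clusterTorus.1 ht)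

theorem incl_torusBasis_mem_basisS (i : (ℤ × ℕ × ℕ) ⊕ ℕ) : incl (torusBasis i) ∈ basisS := by
  rw [basisS_eq]; exact ⟨i, rfl⟩

theorem basisS_subset_clusterAlgebra : basisS ⊆ clusterAlgebra := by
  rw [basisS_eq]
  rintro _ ⟨i, rfl⟩
  exact incl_torusBasis_mem_clusterAlgebra i

theorem coeffRing_le_clusterAlgebra : coeffRing ≤ clusterAlgebra :=
  fun _ h => Subring.subset_closure (Or.inl h)

/-! ### Basis property and structure constants -/

theorem isLeftBasis_basisS : IsLeftBasis coeffRing clusterAlgebra basisS := by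
  constructor
  · have : LinearIndependent coeffRing fun i => incl (torusBasis i) := by
      rw [linearIndependent_iff']
      intro s g h i hi
      have hg : ∀ i, ∃ f ∈ coeffTorus, incl f = g i := fun i =>
        mem_coeffRing.1 (g i).2
      choose f hf hfg using hg
      have := torusBasis_linearIndependent_left s f hf (incl_injective (by
        rw [map_sum, map_zero, ← h]
        refine Finset.sum_congr rfl fun i _ => ?_
        rw [map_mul, hfg]
        rfl)) i hi
      exact Subtype.ext (by rw [← hfg, this, map_zero]; rfl)
    have := this.linearIndepOn_id
    rwa [← basisS_eq] at this
  · refine Set.Subset.antisymm (fun x hx => ?_) ?_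
    · induction hx using Submodule.span_induction with
      | mem x hx => exact basisS_subset_clusterAlgebra hx
      | zero => exact zero_mem _
      | add x y _ _ hx hy => exact add_mem hx hy
      | smul a x _ hx => exact mul_mem (coeffRing_le_clusterAlgebra a.2) hx
    · rw [clusterAlgebra_eq]
      rintro _ ⟨t, ht, rfl⟩
      exact coeffSpan_le
        (P := (Submodule.span coeffRing basisS).toAddSubmonoid.comap (incl : Torus →+ Frac))
        (fun c hc i => by
          have hc' : incl c ∈ coeffRing := mem_coeffRing.2 ⟨c, hc, rfl⟩
          change incl (c * torusBasis i) ∈ Submodule.span coeffRing basisS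
          rw [map_mul]
          exact Submodule.smul_mem _ (⟨_, hc'⟩ : coeffRing)
            (Submodule.subset_span (incl_torusBasis_mem_basisS i))) (mem_clusterTorus.1 ht)

theorem isRightBasis_basisS : IsRightBasis coeffRing clusterAlgebra basisS := by
  constructor
  · have : LinearIndependent coeffRing.op fun i => incl (torusBasis i) := by
      rw [linearIndependent_iff']
      intro s g h i hi
      have hg : ∀ i, ∃ f ∈ coeffTorus, incl f = (g i).1.unop := fun i =>
        mem_coeffRing.1 (show (g i).1.unop ∈ coeffRing from (g i).2)
      choose f hf hfg using hg
      have := torusBasis_linearIndependent_right s f hf (incl_injective (by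
        rw [map_sum, map_zero, ← h]
        refine Finset.sum_congr rfl fun i _ => ?_
        rw [map_mul, hfg]
        rfl)) i hi
      exact Subtype.ext (MulOpposite.unop_injective (by rw [← hfg, this, map_zero]; rfl))
    have := this.linearIndepOn_id
    rwa [← basisS_eq] at this
  · refine Set.Subset.antisymm (fun x hx => ?_) ?_
    · induction hx using Submodule.span_induction with
      | mem x hx => exact basisS_subset_clusterAlgebra hx
      | zero => exact zero_mem _
      | add x y _ _ hx hy => exact add_mem hx hy
      | smul a x _ hx => exact mul_mem hx (coeffRing_le_clusterAlgebra a.2)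
    · rw [clusterAlgebra_eq]
      rintro _ ⟨t, ht, rfl⟩
      exact coeffSpan_le
        (P := (Submodule.span coeffRing.op basisS).toAddSubmonoid.comap (incl : Torus →+ Frac))
        (fun c hc i => by
          -- The cluster algebra is known as a left span; each coefficient is moved to the right of
          -- its basis element.
          obtain ⟨g, hg, e⟩ := isCoeffSemiring_coeffTorus.exists_mul_torusBasis hc i
          have hg' : incl g ∈ coeffRing := mem_coeffRing.2 ⟨g, hg, rfl⟩
          change incl (c * torusBasis i) ∈ Submodule.span coeffRing.op basisS
          rw [e, map_mul]
          exact Submodule.smul_mem _ (⟨MulOpposite.op (incl g), hg'⟩ : coeffRing.op)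
            (Submodule.subset_span (incl_torusBasis_mem_basisS i))) (mem_clusterTorus.1 ht)

/-- The span over the non-negative semiring is itself closed under multiplication, as straightening
never subtracts. -/
theorem exists_mul_eq_incl {s t : Frac} (hs : s ∈ basisS) (ht : t ∈ basisS) :
    ∃ u ∈ coeffSpan nonnegTorus torusBasis, s * t = incl u := by
  rw [basisS_eq] at hs ht
  obtain ⟨i, rfl⟩ := hs
  obtain ⟨j, rfl⟩ := ht
  have hK := isCoeffSemiring_nonnegTorus
  exact ⟨_, hK.mem_span.1 (mul_mem (hK.torusBasis_mem_span i) (hK.torusBasis_mem_span j)),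
    (map_mul _ _ _).symm⟩

theorem leftStructureConstantsIn_basisS : LeftStructureConstantsIn nonnegCoeffs basisS := by
  intro s hs t ht
  obtain ⟨u, hu, e⟩ := exists_mul_eq_incl hs ht
  rw [e]
  refine coeffSpan_eq_finsupp_sum (coeffSpan_le (K := nonnegTorus)
    (P := (coeffSpan nonnegCoeffs ((↑) : basisS → Frac)).comap (incl : Torus →+ Frac))
    (fun c hc i => ?_) hu)
  have hc' : incl c ∈ nonnegCoeffs := by rw [nonnegCoeffs_eq]; exact ⟨c, hc, rfl⟩
  change incl (c * torusBasis i) ∈ coeffSpan nonnegCoeffs ((↑) : basisS → Frac)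
  rw [map_mul]
  exact mul_mem_coeffSpan (u := ((↑) : basisS → Frac)) hc' (⟨_, incl_torusBasis_mem_basisS i⟩ : basisS)

theorem rightStructureConstantsIn_basisS : RightStructureConstantsIn nonnegCoeffs basisS := by
  classical
  intro s hs t ht
  obtain ⟨u, hu, e⟩ := exists_mul_eq_incl hs ht
  rw [e]
  clear e
  induction hu using AddSubmonoid.closure_induction with
  | mem t ht =>
    obtain ⟨f, hf, i, rfl⟩ := ht
    obtain ⟨g, hg, e⟩ := isCoeffSemiring_nonnegTorus.exists_mul_torusBasis hf i
    refine ⟨Finsupp.single ⟨_, incl_torusBasis_mem_basisS i⟩ (incl g), fun u => ?_, ?_⟩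
    · rw [Finsupp.single_apply, nonnegCoeffs_eq]
      split_ifs
      exacts [⟨g, hg, rfl⟩, zero_mem _]
    · rw [e, map_mul, Finsupp.sum_single_index (mul_zero _)]
  | zero => exact ⟨0, fun _ => zero_mem _, by simp⟩
  | add a b _ _ ha hb =>
    obtain ⟨c, hc, hc'⟩ := ha
    obtain ⟨d, hd, hd'⟩ := hb
    refine ⟨c + d, fun i => add_mem (hc i) (hd i), ?_⟩
    rw [map_add, hc', hd', Finsupp.sum_add_index' (by simp) (by simp [mul_add])]

end Kronecker

theorem theorem4p3 :
    -- the union of the cluster monomials and the `S_n`, `n ≥ 1`, is disjoint, without repetitions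
    Disjoint Kronecker.clusterMonomials {x | ∃ n, 1 ≤ n ∧ x = Kronecker.cheb n} ∧
    Set.InjOn Kronecker.cheb {n | 1 ≤ n} ∧
    -- it is a basis of the quantum cluster algebra over the ring of coefficients
    IsLeftBasis Kronecker.coeffRing Kronecker.clusterAlgebra Kronecker.basisS ∧
    IsRightBasis Kronecker.coeffRing Kronecker.clusterAlgebra Kronecker.basisS ∧
    -- its elements are bar-invariant
    (∀ x ∈ Kronecker.basisS, Kronecker.IsBarInvariant x) ∧
    -- its structure constants are non-negative
    LeftStructureConstantsIn Kronecker.nonnegCoeffs Kronecker.basisS ∧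
    RightStructureConstantsIn Kronecker.nonnegCoeffs Kronecker.basisS :=
  ⟨Kronecker.disjoint_clusterMonomials_cheb, Kronecker.cheb_injective.injOn,
    Kronecker.isLeftBasis_basisS, Kronecker.isRightBasis_basisS,
    fun _ => Kronecker.isBarInvariant_of_mem_basisS, Kronecker.leftStructureConstantsIn_basisS,
    Kronecker.rightStructureConstantsIn_basisS⟩
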